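/- Let $d\ge 2$, $a,b\in(0,\infty)$, and let $e_1$ be the first standard basis vector of $\mathbb R^d$ (with Euclidean norm $\|\cdot\|$). For $x\in\mathbb R^d\setminus\{0\}$ put $\hat x=x/\|x\|$, and put $\hat 0=e_1$. For each unit vector $u$ let $Q_u$ be an orthogonal $d\times d$ matrix with $Q_u e_1=u$, and let $D=\sqrt d\,\operatorname{diag}(a,b,\dots,b)$. Let $X=(X_n)_{n\ge 0}$ be an elliptic random walk on $\mathbb R^d$, that is, a process started from a fixed point $X_0=x_0\in\mathbb R^d$ such that, for every $n\ge 0$, the conditional law of the increment $X_{n+1}-X_n$ given $X_0,\dots,X_n$ is the law of $Q_{\hat x}D\zeta$ evaluated at $x=X_n$, where $\zeta$ is uniformly distributed on the unit sphere of $\mathbb R^d$. Then: (i) if $a^2<(d-1)b^2$, then $X$ is transient: $\lim_{n\to\infty}\|X_n\|=\infty$ almost surely; (ii) if $a^2\ge(d-1)b^2$, then $X$ is null-recurrent: there is a constant $r_0\in[0,\infty)$ such that $\liminf_{n\to\infty}\|X_n\|\le r_0$ almost surely (recurrence), and for every bounded $A\subset\mathbb R^d$, $$\lim_{n\to\infty}\frac1n\sum_{k=0}^{n-1}\mathbf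 1\{X_k\in A\}=0\quad\text{almost surely and in }L^q\text{ for every }q\in[1,\infty)\quad\text{(nullity)}.$$ -/

import Mathlib

open MeasureTheory ProbabilityTheory Filter Topology
open scoped ENNReal NNReal

noncomputable section

namespace EllipticWalk

/-- `ℝ^d` with the Euclidean norm. -/
abbrev Vec (d : ℕ) : Type := EuclideanSpace ℝ (Fin d)

/-- The first standard basis vector (coordinates are numbered from `0`). -/
def e₁ (d : ℕ) : Vec d := WithLp.toLp 2 fun i => if (i : ℕ) = 0 then 1 else 0

/-- The direction `x / ‖x‖` of `x`, with the convention that the direction of `0` is `e₁`. -/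
def direction {d : ℕ} (x : Vec d) : Vec d := if x = 0 then e₁ d else ‖x‖⁻¹ • x

/-- The uniform distribution on the unit sphere: normalised surface measure. -/
def uniformSphere (d : ℕ) : Measure (Metric.sphere (0 : Vec d) 1) :=
  ((volume : Measure (Vec d)).toSphere Set.univ)⁻¹ • (volume : Measure (Vec d)).toSphere

/-- The matrix `D = √d · diag(a, b, …, b)`. -/
def axesMatrix (d : ℕ) (a b : ℝ) : Matrix (Fin d) (Fin d) ℝ :=
  √(d : ℝ) • Matrix.diagonal fun i : Fin d => if (i : ℕ) = 0 then a else b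

/-- `Q` assigns to every unit vector `u` an orthogonal matrix `Q u` that maps `e₁` to `u`
(no regularity in `u` is required). -/
def IsFrame {d : ℕ} (Q : Vec d → Matrix (Fin d) (Fin d) ℝ) : Prop :=
  ∀ u : Vec d, ‖u‖ = 1 →
    Q u ∈ Matrix.orthogonalGroup (Fin d) ℝ ∧ Matrix.toEuclideanLin (Q u) (e₁ d) = u

/-- The law of the increment at position `x`, that is of `Q_{x̂} D ζ` with `ζ` uniform on the
unit sphere. -/
def incrementLaw {d : ℕ} (a b : ℝ) (Q : Vec d → Matrix (Fin d) (Fin d) ℝ) (x : Vec d) :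
    Measure (Vec d) :=
  (uniformSphere d).map fun ζ : Metric.sphere (0 : Vec d) 1 =>
    Matrix.toEuclideanLin (Q (direction x) * axesMatrix d a b) (ζ : Vec d)

/-- `X` is an elliptic random walk with parameters `a, b` started from `x₀`: given
`X 0, …, X n`, the increment `X (n + 1) - X n` has the law `incrementLaw a b Q (X n)`. -/
structure IsEllipticWalk {Ω : Type*} [MeasurableSpace Ω] (P : Measure Ω) {d : ℕ} (a b : ℝ)
    (Q : Vec d → Matrix (Fin d) (Fin d) ℝ) (x₀ : Vec d) (X : ℕ → Ω → Vec d) : Prop where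
  measurable : ∀ n, Measurable (X n)
  start : ∀ᵐ ω ∂P, X 0 ω = x₀
  increment : ∀ (n : ℕ) (B : Set (Vec d)), MeasurableSet B →
    P⟦(fun ω => X (n + 1) ω - X n ω) ⁻¹' B |
        Filtration.natural X (fun k => (measurable k).stronglyMeasurable) n⟧
      =ᵐ[P] fun ω => (incrementLaw a b Q (X n ω)).real B

/-- Transience: `‖X n‖ → ∞` almost surely. -/
def IsTransient {Ω : Type*} [MeasurableSpace Ω] (P : Measure Ω) {d : ℕ}
    (X : ℕ → Ω → Vec d) : Prop :=
  ∀ᵐ ω ∂P, Tendsto (fun n => ‖X n ω‖) atTop atTop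

/-- Recurrence: `liminf ‖X n‖ ≤ r₀` almost surely for some constant `r₀ ∈ [0, ∞)`. The lower
limit is taken in `[0, ∞]`. -/
def IsRecurrent {Ω : Type*} [MeasurableSpace Ω] (P : Measure Ω) {d : ℕ}
    (X : ℕ → Ω → Vec d) : Prop :=
  ∃ r₀ : ℝ≥0, ∀ᵐ ω ∂P, liminf (fun n => ‖X n ω‖ₑ) atTop ≤ (r₀ : ℝ≥0∞)

/-- The proportion of the times `0, …, n - 1` at which the walk is in `A`. -/
def occupation {Ω : Type*} {d : ℕ} (X : ℕ → Ω → Vec d) (A : Set (Vec d)) (n : ℕ) (ω : Ω) : ℝ :=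
  (1 / (n : ℝ)) * ∑ k ∈ Finset.range n, A.indicator (fun _ => (1 : ℝ)) (X k ω)

/-- Nullity: the proportion of time spent in any bounded set tends to `0` almost surely and in
`L^q` for every (finite) `q ≥ 1`. -/
def IsNull {Ω : Type*} [MeasurableSpace Ω] (P : Measure Ω) {d : ℕ}
    (X : ℕ → Ω → Vec d) : Prop :=
  ∀ A : Set (Vec d), Bornology.IsBounded A →
    (∀ᵐ ω ∂P, Tendsto (fun n => occupation X A n ω) atTop (𝓝 0)) ∧
    ∀ q : ℝ, 1 ≤ q →
      Tendsto (fun n => eLpNorm (occupation X A n) (ENNReal.ofReal q) P) atTop (𝓝 0)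

/-- Null-recurrence: recurrent and null. -/
def IsNullRecurrent {Ω : Type*} [MeasurableSpace Ω] (P : Measure Ω) {d : ℕ}
    (X : ℕ → Ω → Vec d) : Prop :=
  IsRecurrent P X ∧ IsNull P X

end EllipticWalk

end

/-! By rotation invariance of the sphere, `Q_u D ζ` has the law of a stretch of `ζ` by `p = √d a`
along `u` and by `q = √d b` across it. So `R = ‖X‖` is autonomous: from `r` it moves to `√((r + p
s)² + q² (1 - s²))`, where `s` is one coordinate of a uniform point of the sphere, symmetric with
second moment `v = 1/d`. Far out, `R` has mean drift about `q² (1 - v) / (2r)` and increment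
variance about `p² v`. This is Lamperti's setting, with the threshold at `q² (1 - v) = p² v`, that
is `(d - 1) b² = a²`.

Nullity holds in both regimes (`ae_tendsto_visits`). The mean of `R` increases at every step, by at
least a fixed multiple of the probability of being in `[0, L]`. Summing, the expected number of
visits before time `n` is at most a constant times `E R_n`, which is `O(√n)` because `E R_n²` grows
at most linearly. Along `n = 4^k` the expected proportions are summable, and monotonicity fills the
gaps. In particular `R` is almost surely unbounded (`ae_frequently_gt`).

Unboundedness and a Lyapunov function then decide each regime. If `p² v < q² (1 - v)`, a small
negative power of `R`, frozen near the origin, is a non-negative supermartingale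
(`exists_integral_exp_le`). Its limit must be `0`, so `R → ∞`. Otherwise `log (R² - C)`, killed on
entering `[0, r₁]`, is one (`exists_integral_log_le`). It converges, which is incompatible with an
unbounded path that never enters, so every tail of the path enters `[0, r₁]`. The shift `C` makes
the criterion reach the critical case of equality. -/

open scoped Pointwise

namespace EllipticWalk

/-! ### The uniform distribution on the sphere -/

/-- The uniform distribution on the unit sphere, as a measure on the ambient space. -/
noncomputable def sphereLaw (d : ℕ) : Measure (Vec d) :=
  (uniformSphere d).map Subtype.val

lemma sphereLaw_apply {d : ℕ} {B : Set (Vec d)} (hB : MeasurableSet B) :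
    sphereLaw d B = ((volume : Measure (Vec d)).toSphere Set.univ)⁻¹ *
      (Module.finrank ℝ (Vec d) * (volume : Measure (Vec d))
        (Set.Ioo (0 : ℝ) 1 • (B ∩ Metric.sphere 0 1))) := by
  rw [sphereLaw, Measure.map_apply measurable_subtype_coe hB, uniformSphere, Measure.smul_apply,
    Measure.toSphere_apply' _ (measurable_subtype_coe hB), Subtype.image_preimage_coe,
    Set.inter_comm, smul_eq_mul]

lemma isProbabilityMeasure_uniformSphere {d : ℕ} (hd : 2 ≤ d) :
    IsProbabilityMeasure (uniformSphere d) := by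
  have : Nonempty (Fin d) := ⟨⟨0, by omega⟩⟩
  refine ⟨?_⟩
  rw [uniformSphere, Measure.smul_apply, smul_eq_mul]
  refine ENNReal.inv_mul_cancel ?_ (measure_ne_top _ _)
  rw [Ne, Measure.measure_univ_eq_zero]
  exact Measure.toSphere_ne_zero _

lemma isProbabilityMeasure_sphereLaw {d : ℕ} (hd : 2 ≤ d) :
    IsProbabilityMeasure (sphereLaw d) := by
  have := isProbabilityMeasure_uniformSphere hd
  exact Measure.isProbabilityMeasure_map measurable_subtype_coe.aemeasurable

lemma ae_sphereLaw_norm (d : ℕ) : ∀ᵐ ζ ∂(sphereLaw d), ‖ζ‖ = 1 := by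
  rw [sphereLaw, ae_map_iff measurable_subtype_coe.aemeasurable
    (measurableSet_eq_fun measurable_norm measurable_const)]
  exact Eventually.of_forall fun ζ => by simp

/-- Surface measure of a set is, up to a constant, the volume of the cone over it. A linear isometry
commutes with forming cones and preserves volume. -/
lemma sphereLaw_map_isometry {d : ℕ} (e : Vec d ≃ₗᵢ[ℝ] Vec d) :
    (sphereLaw d).map e = sphereLaw d := by
  ext B hB
  have hem : Measurable e := e.continuous.measurable
  rw [Measure.map_apply hem hB, sphereLaw_apply hB, sphereLaw_apply (hem hB)]
  have h : Set.Ioo (0 : ℝ) 1 • (e ⁻¹' B ∩ Metric.sphere 0 1) =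
      e ⁻¹' (Set.Ioo (0 : ℝ) 1 • (B ∩ Metric.sphere 0 1)) := by
    ext x
    simp only [Set.mem_smul, Set.mem_preimage, Set.mem_inter_iff, mem_sphere_zero_iff_norm]
    constructor
    · rintro ⟨r, hr, y, ⟨hy, hy1⟩, rfl⟩
      exact ⟨r, hr, e y, ⟨hy, by simpa using hy1⟩, by simp⟩
    · rintro ⟨r, hr, y, ⟨hy, hy1⟩, h⟩
      refine ⟨r, hr, e.symm y, ⟨by simpa using hy, by simpa using hy1⟩, ?_⟩
      apply e.injective
      simpa using h
  rw [h]
  congr 2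
  exact e.measurePreserving.measure_preimage_equiv (f := e.toMeasurableEquiv) _

/-- The law of one coordinate of a uniform point of the unit sphere. -/
noncomputable def coordLaw (d : ℕ) : Measure ℝ :=
  (sphereLaw d).map fun ζ => inner ℝ ζ (e₁ d)

lemma measurable_inner_left {d : ℕ} (u : Vec d) : Measurable fun ζ : Vec d => inner ℝ ζ u :=
  (continuous_id.inner continuous_const).measurable

lemma e₁_eq_single {d : ℕ} (hd : 0 < d) : e₁ d = EuclideanSpace.single ⟨0, hd⟩ 1 := by
  ext i
  simp [e₁, Fin.ext_iff]

lemma norm_e₁ {d : ℕ} (hd : 0 < d) : ‖e₁ d‖ = 1 := by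
  simp [e₁_eq_single hd]

lemma sphereLaw_map_inner {d : ℕ} (e : Vec d ≃ₗᵢ[ℝ] Vec d) {u : Vec d} (h : e (e₁ d) = u) :
    (sphereLaw d).map (fun ζ => inner ℝ ζ u) = coordLaw d := by
  rw [← sphereLaw_map_isometry e, Measure.map_map (measurable_inner_left u)
    e.continuous.measurable, coordLaw]
  congr 1
  ext ζ
  simp [← h]

lemma isProbabilityMeasure_coordLaw {d : ℕ} (hd : 2 ≤ d) :
    IsProbabilityMeasure (coordLaw d) := by
  have := isProbabilityMeasure_sphereLaw hd
  exact Measure.isProbabilityMeasure_map (measurable_inner_left _).aemeasurable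

lemma ae_coordLaw_abs_le {d : ℕ} (hd : 2 ≤ d) : ∀ᵐ s ∂(coordLaw d), |s| ≤ 1 := by
  rw [coordLaw, ae_map_iff (measurable_inner_left _).aemeasurable
    (measurableSet_le (f := fun s : ℝ => |s|) (by fun_prop) measurable_const)]
  filter_upwards [ae_sphereLaw_norm d] with ζ hζ
  simpa [hζ, norm_e₁ (show 0 < d by omega)] using abs_real_inner_le_norm ζ (e₁ d)

lemma coordLaw_map_neg (d : ℕ) : (coordLaw d).map (fun s => -s) = coordLaw d := by
  conv_rhs => rw [coordLaw, ← sphereLaw_map_isometry (LinearIsometryEquiv.neg ℝ)]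
  rw [Measure.map_map (measurable_inner_left _) (LinearIsometryEquiv.neg ℝ).continuous.measurable,
    coordLaw, Measure.map_map measurable_neg (measurable_inner_left _)]
  congr 1
  ext ζ
  simp

/-- Swapping coordinates is an isometry, so all `d` coordinates have the same law, and their squares
sum to `1`. -/
lemma integral_sq_coordLaw {d : ℕ} (hd : 2 ≤ d) : ∫ s, s ^ 2 ∂(coordLaw d) = 1 / d := by
  have := isProbabilityMeasure_sphereLaw hd
  have := isProbabilityMeasure_coordLaw hd
  have hd0 : 0 < d := by omega
  have hi : ∀ i : Fin d, (sphereLaw d).map (fun ζ => ζ i) = coordLaw d := by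
    intro i
    have := sphereLaw_map_inner (d := d)
      (LinearIsometryEquiv.piLpCongrLeft 2 ℝ ℝ (Equiv.swap ⟨0, hd0⟩ i))
      (u := EuclideanSpace.single i 1) (by
        rw [e₁_eq_single hd0, EuclideanSpace.piLpCongrLeft_single, Equiv.swap_apply_left])
    rw [← this]
    congr 1
    ext ζ
    simp [EuclideanSpace.inner_single_right]
  have hmeas : ∀ i : Fin d, Measurable fun ζ : Vec d => ζ i := fun i => by fun_prop
  have hint : Integrable (fun s : ℝ => s ^ 2) (coordLaw d) := by
    refine Integrable.of_bound (by fun_prop) 1 ?_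
    filter_upwards [ae_coordLaw_abs_le hd] with s hs
    rw [Real.norm_eq_abs, abs_pow]
    exact pow_le_one₀ (abs_nonneg _) hs
  have h1 : ∀ i : Fin d, ∫ ζ, (ζ i) ^ 2 ∂(sphereLaw d) = ∫ s, s ^ 2 ∂(coordLaw d) := by
    intro i
    rw [← hi i, integral_map (hmeas i).aemeasurable (by fun_prop)]
  have h2 : ∀ i : Fin d, Integrable (fun ζ : Vec d => (ζ i) ^ 2) (sphereLaw d) := by
    intro i
    rw [← hi i] at hint
    exact hint.comp_measurable (hmeas i)
  have h3 : ∑ i : Fin d, ∫ ζ, (ζ i) ^ 2 ∂(sphereLaw d) = 1 := by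
    rw [← integral_finsetSum _ fun i _ => h2 i]
    have : ∀ᵐ ζ ∂(sphereLaw d), ∑ i : Fin d, (ζ i) ^ 2 = (1 : ℝ) := by
      filter_upwards [ae_sphereLaw_norm d] with ζ hζ
      rw [← EuclideanSpace.real_norm_sq_eq, hζ, one_pow]
    rw [integral_congr_ae this]
    simp
  simp only [h1, Finset.sum_const, Finset.card_univ, Fintype.card_fin, nsmul_eq_mul] at h3
  field_simp
  linarith

/-! ### The law of the increments -/

/-- The linear map with semi-axis `p` along the unit vector `u` and `q` across. -/
noncomputable def stretch {d : ℕ} (p q : ℝ) (u ζ : Vec d) : Vec d :=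
  q • ζ + ((p - q) * inner ℝ ζ u) • u

/-- An orthogonal matrix as a linear isometry. -/
lemma exists_isometry_of_orthogonal {d : ℕ} {M : Matrix (Fin d) (Fin d) ℝ}
    (hM : M ∈ Matrix.orthogonalGroup (Fin d) ℝ) :
    ∃ e : Vec d ≃ₗᵢ[ℝ] Vec d, ∀ ζ, e ζ = Matrix.toEuclideanLin M ζ := by
  have h1 : M * star M = 1 := (Matrix.mem_unitaryGroup_iff).1 hM
  have h2 : star M * M = 1 := (Matrix.mem_unitaryGroup_iff').1 hM
  have hinner : ∀ x y : Vec d,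
      inner ℝ (Matrix.toEuclideanLin M x) (Matrix.toEuclideanLin M y) = inner ℝ x y := by
    intro x y
    rw [← LinearMap.adjoint_inner_right, ← Matrix.toEuclideanLin_conjTranspose_eq_adjoint]
    rw [← Matrix.star_eq_conjTranspose]
    congr 1
    ext i
    simp [Matrix.toLpLin_apply, Matrix.mulVec_mulVec, h2]
  let f : Vec d →ₗᵢ[ℝ] Vec d := LinearMap.isometryOfInner (Matrix.toEuclideanLin M) hinner
  refine ⟨f.toLinearIsometryEquiv rfl, fun ζ => ?_⟩
  simp [f]

lemma axesMatrix_apply {d : ℕ} (hd : 0 < d) (a b : ℝ) (ζ : Vec d) :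
    Matrix.toEuclideanLin (axesMatrix d a b) ζ = stretch (√d * a) (√d * b) (e₁ d) ζ := by
  ext i
  simp only [axesMatrix, stretch, e₁_eq_single hd, Matrix.toLpLin_apply, Matrix.smul_mulVec,
    EuclideanSpace.inner_single_right]
  by_cases h : i = ⟨0, hd⟩
  · subst h
    simp [Matrix.mulVec_diagonal]
    ring
  · have : (i : ℕ) ≠ 0 := fun h' => h (Fin.ext h')
    simp [Matrix.mulVec_diagonal, h, this]
    ring

lemma norm_direction {d : ℕ} (hd : 0 < d) (x : Vec d) : ‖direction x‖ = 1 := by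
  unfold direction
  split_ifs with h
  · exact norm_e₁ hd
  · rw [norm_smul, norm_inv, norm_norm, inv_mul_cancel₀ (norm_ne_zero_iff.2 h)]

lemma norm_smul_direction {d : ℕ} (x : Vec d) : ‖x‖ • direction x = x := by
  unfold direction
  split_ifs with h
  · simp [h]
  · rw [smul_smul, mul_inv_cancel₀ (norm_ne_zero_iff.2 h), one_smul]

lemma measurable_direction {d : ℕ} : Measurable (direction : Vec d → Vec d) := by
  unfold direction
  exact Measurable.ite (measurableSet_singleton 0) measurable_const
    (measurable_norm.inv.smul measurable_id)

lemma measurable_stretch {d : ℕ} (p q : ℝ) :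
    Measurable fun z : Vec d × Vec d => stretch p q z.1 z.2 := by
  unfold stretch
  have : Continuous fun z : Vec d × Vec d => q • z.2 + ((p - q) * inner ℝ z.2 z.1) • z.1 := by
    fun_prop
  exact this.measurable

/-- Since `Q D ζ` is the stretch of `Q ζ` along `Q e₁`, and `Q ζ` has the law of `ζ`, only the
direction survives from `Q`. This makes the law measurable in `x`, although `Q` itself may not be.
-/
lemma incrementLaw_eq {d : ℕ} (hd : 0 < d) (a b : ℝ) {Q : Vec d → Matrix (Fin d) (Fin d) ℝ}
    (hQ : IsFrame Q) (x : Vec d) :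
    incrementLaw a b Q x =
      (sphereLaw d).map (stretch (√d * a) (√d * b) (direction x)) := by
  obtain ⟨hO, hu⟩ := hQ _ (norm_direction hd x)
  obtain ⟨e, he⟩ := exists_isometry_of_orthogonal hO
  have hm : Measurable (stretch (√d * a) (√d * b) (direction x)) :=
    (measurable_stretch _ _).comp (measurable_const.prodMk measurable_id)
  rw [← sphereLaw_map_isometry e, Measure.map_map hm e.continuous.measurable, sphereLaw,
    Measure.map_map (hm.comp e.continuous.measurable) measurable_subtype_coe, incrementLaw]
  congr 1
  ext1 ζ
  have h1 : Matrix.toEuclideanLin (Q (direction x) * axesMatrix d a b) (ζ : Vec d) =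
      e (Matrix.toEuclideanLin (axesMatrix d a b) (ζ : Vec d)) := by
    rw [he]
    simp [Matrix.toLpLin_apply, Matrix.mulVec_mulVec]
  have h2 : e (e₁ d) = direction x := by rw [he, hu]
  rw [h1, axesMatrix_apply hd]
  simp only [Function.comp_apply, stretch, map_add, map_smul, h2]
  rw [← h2, e.inner_map_map]

/-- The distance from the origin after a step from distance `r`, if the noise has coordinate `s`
in the radial direction. -/
noncomputable def radialStep (p q r s : ℝ) : ℝ := √((r + p * s) ^ 2 + q ^ 2 * (1 - s ^ 2))

lemma continuous_radialStep (p q : ℝ) : Continuous fun z : ℝ × ℝ => radialStep p q z.1 z.2 := by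
  unfold radialStep
  fun_prop

lemma measurable_radialStep (p q r : ℝ) : Measurable (radialStep p q r) := by
  unfold radialStep
  fun_prop

/-- The new position is `(r + (p - q) s) u + q ζ` with `s` the inner product of `ζ` and `u`, so its
norm involves `ζ` only through `s`. This is why the radial process is autonomous. -/
lemma norm_add_stretch {d : ℕ} (hd : 0 < d) (p q : ℝ) (x : Vec d) {ζ : Vec d} (hζ : ‖ζ‖ = 1) :
    ‖x + stretch p q (direction x) ζ‖ =
      radialStep p q ‖x‖ (inner ℝ ζ (direction x)) := by
  set u := direction x with hu
  have hu1 : ‖u‖ = 1 := norm_direction hd x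
  have hx : ‖x‖ • u = x := norm_smul_direction x
  have h : ‖x + stretch p q u ζ‖ ^ 2 =
      (‖x‖ + p * inner ℝ ζ u) ^ 2 + q ^ 2 * (1 - inner ℝ ζ u ^ 2) := by
    have h1 : x + stretch p q u ζ = (‖x‖ + (p - q) * inner ℝ ζ u) • u + q • ζ := by
      rw [stretch, add_smul, hx]
      abel
    rw [h1, norm_add_sq_real, norm_smul, norm_smul, hu1, hζ, inner_smul_left, inner_smul_right,
      real_inner_comm, mul_one, mul_one, Real.norm_eq_abs, Real.norm_eq_abs, sq_abs, sq_abs]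
    simp only [conj_trivial]
    ring
  rw [radialStep, ← h, Real.sqrt_sq (norm_nonneg _)]

/-! ### The radial chain -/

section RadialChain

variable {Ω : Type*} {m : MeasurableSpace Ω} [mΩ : MeasurableSpace Ω]

/-- A process on `[0, ∞)` that moves from `r` to `radialStep p q r s`, where `s` is drawn from `μ`
independently of the past. -/
structure IsRadialChain (P : Measure Ω) (ℱ : Filtration ℕ mΩ) (p q : ℝ) (μ : Measure ℝ)
    (R : ℕ → Ω → ℝ) : Prop where
  adapted : ∀ n, Measurable[ℱ n] (R n)
  nonneg : ∀ n ω, 0 ≤ R n ω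
  start : ∃ c, ∀ᵐ ω ∂P, R 0 ω ≤ c
  step : ∀ (n : ℕ) (E : Set Ω), MeasurableSet[ℱ n] E → ∀ g : ℝ → ℝ≥0∞, Measurable g →
    ∫⁻ ω in E, g (R (n + 1) ω) ∂P = ∫⁻ ω in E, ∫⁻ s, g (radialStep p q (R n ω) s) ∂μ ∂P

lemma IsFrame.sphereLaw_map_inner {d : ℕ} {Q : Vec d → Matrix (Fin d) (Fin d) ℝ} (hQ : IsFrame Q)
    {u : Vec d} (hu : ‖u‖ = 1) : (sphereLaw d).map (fun ζ => inner ℝ ζ u) = coordLaw d := by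
  obtain ⟨hO, hu'⟩ := hQ u hu
  obtain ⟨e, he⟩ := exists_isometry_of_orthogonal hO
  exact EllipticWalk.sphereLaw_map_inner e (by rw [he, hu'])

lemma isProbabilityMeasure_incrementLaw {d : ℕ} (hd : 2 ≤ d) (a b : ℝ)
    {Q : Vec d → Matrix (Fin d) (Fin d) ℝ} (hQ : IsFrame Q) (x : Vec d) :
    IsProbabilityMeasure (incrementLaw a b Q x) := by
  have := isProbabilityMeasure_sphereLaw hd
  rw [incrementLaw_eq (by omega) a b hQ]
  exact Measure.isProbabilityMeasure_map
    ((measurable_stretch _ _).comp (measurable_const.prodMk measurable_id)).aemeasurable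

/-- Integrated form of a conditional law. -/
lemma measure_inter_preimage_of_condExp {P : Measure Ω} [IsProbabilityMeasure P]
    (hm : m ≤ mΩ) {β : Type*} [MeasurableSpace β] {θ : Ω → β}
    (hθ : Measurable θ) {κ : Ω → Measure β} [∀ ω, IsFiniteMeasure (κ ω)] {B : Set β}
    (hB : MeasurableSet B)
    (h : P⟦θ ⁻¹' B | m⟧ =ᵐ[P] fun ω => (κ ω).real B) {E : Set Ω} (hE : MeasurableSet[m] E) :
    P (E ∩ θ ⁻¹' B) = ∫⁻ ω in E, κ ω B ∂P := by
  have h2 := setIntegral_condExp (μ := P) hm (f := (θ ⁻¹' B).indicator fun _ => (1 : ℝ))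
    ((integrable_const _).indicator (hθ hB)) hE
  rw [setIntegral_congr_ae (hm _ hE) (h.mono fun ω hω _ => hω), setIntegral_indicator (hθ hB),
    setIntegral_const, smul_eq_mul, mul_one] at h2
  have h3 : Integrable (fun ω => (κ ω).real B) (P.restrict E) :=
    (integrable_condExp.congr h).integrableOn
  have h4 := ofReal_integral_eq_lintegral_ofReal h3
    (Eventually.of_forall fun ω => measureReal_nonneg)
  rw [h2, ofReal_measureReal] at h4
  rw [h4]
  exact lintegral_congr fun ω => ofReal_measureReal

lemma measurable_stretch_direction {d : ℕ} (p q : ℝ) :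
    Measurable fun z : Vec d × Vec d => stretch p q (direction z.1) z.2 :=
  Measurable.comp (g := fun z : Vec d × Vec d => stretch p q z.1 z.2)
    (f := fun z : Vec d × Vec d => (direction z.1, z.2)) (measurable_stretch p q)
    ((measurable_direction.comp measurable_fst).prodMk measurable_snd)

/-- The hypothesis handles sets of increments only. It extends to sets of pairs because rectangles
determine the joint law, and on `C ×ˢ B` the condition `Y ∈ C` can be absorbed into the past event
`E`. -/
lemma map_position_increment {P : Measure Ω} [IsProbabilityMeasure P] {d : ℕ}
    (hd : 2 ≤ d) {a b : ℝ} {Q : Vec d → Matrix (Fin d) (Fin d) ℝ} (hQ : IsFrame Q)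
    (hm : m ≤ mΩ) {Y θ : Ω → Vec d} (hY : Measurable[m] Y)
    (hθ : Measurable θ)
    (h : ∀ B, MeasurableSet B → P⟦θ ⁻¹' B | m⟧ =ᵐ[P] fun ω => (incrementLaw a b Q (Y ω)).real B)
    {E : Set Ω} (hE : MeasurableSet[m] E) :
    (P.restrict E).map (fun ω => (Y ω, θ ω)) =
      (((P.restrict E).map Y).prod (sphereLaw d)).map
        fun z => (z.1, stretch (√d * a) (√d * b) (direction z.1) z.2) := by
  have hd0 : 0 < d := by omega
  have := isProbabilityMeasure_sphereLaw hd
  have := isProbabilityMeasure_incrementLaw hd a b hQ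
  have hT := measurable_stretch_direction (d := d) (√d * a) (√d * b)
  have hY' : Measurable Y := hY.mono hm le_rfl
  have hφ : Measurable fun z : Vec d × Vec d =>
      (z.1, stretch (√d * a) (√d * b) (direction z.1) z.2) := measurable_fst.prodMk hT
  refine Measure.ext_prod fun {C B} hC hB => ?_
  have hset := hφ (hC.prod hB)
  rw [Measure.map_apply (hY'.prodMk hθ) (hC.prod hB), Measure.map_apply hφ (hC.prod hB),
    Measure.prod_apply hset, lintegral_map (measurable_measure_prodMk_left hset) hY',
    Measure.restrict_apply' (hm _ hE)]
  have h5 : ∀ ω, sphereLaw d (Prod.mk (Y ω) ⁻¹' ((fun z : Vec d × Vec d =>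
      (z.1, stretch (√d * a) (√d * b) (direction z.1) z.2)) ⁻¹' (C ×ˢ B))) =
      (Y ⁻¹' C).indicator (fun ω => incrementLaw a b Q (Y ω) B) ω := by
    intro ω
    by_cases h : Y ω ∈ C
    · have hTω : Measurable (stretch (√d * a) (√d * b) (direction (Y ω))) :=
        hT.comp (measurable_prodMk_left (x := Y ω))
      rw [Set.indicator_of_mem (by exact h), incrementLaw_eq hd0 a b hQ,
        Measure.map_apply hTω hB]
      congr 1
      ext ζ
      simp [h]
    · rw [Set.indicator_of_notMem (by exact h)]
      convert measure_empty (μ := sphereLaw d)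
      ext ζ
      simp [h]
  simp only [h5]
  rw [lintegral_indicator (hY' hC), Measure.restrict_restrict (hY' hC), Set.inter_comm (Y ⁻¹' C),
    ← measure_inter_preimage_of_condExp (κ := fun ω => incrementLaw a b Q (Y ω)) hm hθ hB (h B hB)
      (hE.inter (hY hC))]
  congr 1
  ext ω
  simp only [Set.mem_inter_iff, Set.mem_preimage, Set.mem_prod]
  tauto

/-- In every direction the radial coordinate of `ζ` has the same law `coordLaw d`, so the integral
over the noise depends on `Y` only through `‖Y‖`. -/
lemma lintegral_norm_add {P : Measure Ω} [IsProbabilityMeasure P] {d : ℕ}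
    (hd : 2 ≤ d) {a b : ℝ} {Q : Vec d → Matrix (Fin d) (Fin d) ℝ} (hQ : IsFrame Q)
    (hm : m ≤ mΩ) {Y θ : Ω → Vec d} (hY : Measurable[m] Y)
    (hθ : Measurable θ)
    (h : ∀ B, MeasurableSet B → P⟦θ ⁻¹' B | m⟧ =ᵐ[P] fun ω => (incrementLaw a b Q (Y ω)).real B)
    {E : Set Ω} (hE : MeasurableSet[m] E) {g : ℝ → ℝ≥0∞} (hg : Measurable g) :
    ∫⁻ ω in E, g ‖Y ω + θ ω‖ ∂P =
      ∫⁻ ω in E, ∫⁻ s, g (radialStep (√d * a) (√d * b) ‖Y ω‖ s) ∂(coordLaw d) ∂P := by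
  have hd0 : 0 < d := by omega
  have := isProbabilityMeasure_sphereLaw hd
  have hT := measurable_stretch_direction (d := d) (√d * a) (√d * b)
  have hY' : Measurable Y := hY.mono hm le_rfl
  have hG : Measurable fun z : Vec d × Vec d => g ‖z.1 + z.2‖ :=
    hg.comp (measurable_fst.add measurable_snd).norm
  have hGT := hG.comp (measurable_fst.prodMk hT)
  have h1 := lintegral_map (μ := P.restrict E) hG (hY'.prodMk hθ)
  rw [← h1, map_position_increment hd hQ hm hY hθ h hE,
    lintegral_map hG (measurable_fst.prodMk hT)]
  have h3 := lintegral_prod (μ := (P.restrict E).map Y) (ν := sphereLaw d) _ hGT.aemeasurable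
  simp only [Function.comp_def] at h3
  have h4 := hGT.lintegral_prod_right' (ν := sphereLaw d)
  simp only [Function.comp_def] at h4
  rw [h3, lintegral_map h4 hY']
  refine lintegral_congr fun ω => ?_
  rw [← hQ.sphereLaw_map_inner (norm_direction hd0 (Y ω)),
    lintegral_map (f := fun s => g (radialStep (√d * a) (√d * b) ‖Y ω‖ s))
      (hg.comp (measurable_radialStep _ _ _)) (measurable_inner_left _)]
  refine lintegral_congr_ae ?_
  filter_upwards [ae_sphereLaw_norm d] with ζ hζ
  rw [norm_add_stretch hd0 _ _ _ hζ]

lemma IsEllipticWalk.isRadialChain {P : Measure Ω} [IsProbabilityMeasure P] {d : ℕ}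
    (hd : 2 ≤ d) {a b : ℝ} {Q : Vec d → Matrix (Fin d) (Fin d) ℝ} (hQ : IsFrame Q) {x₀ : Vec d}
    {X : ℕ → Ω → Vec d} (hX : IsEllipticWalk P a b Q x₀ X) :
    IsRadialChain P (Filtration.natural X fun k => (hX.measurable k).stronglyMeasurable)
      (√d * a) (√d * b) (coordLaw d) (fun n ω => ‖X n ω‖) where
  adapted n := (Filtration.stronglyAdapted_natural (u := X) (fun k =>
    (hX.measurable k).stronglyMeasurable) n).norm.measurable
  nonneg n ω := norm_nonneg _
  start := ⟨‖x₀‖, hX.start.mono fun ω h => by rw [h]⟩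
  step n E hE g hg := by
    have h := lintegral_norm_add hd hQ (Filtration.le _ n) (Y := X n)
      (θ := fun ω => X (n + 1) ω - X n ω)
      (Filtration.stronglyAdapted_natural (u := X) (fun k =>
        (hX.measurable k).stronglyMeasurable) n).measurable
      ((hX.measurable _).sub (hX.measurable _)) (hX.increment n) hE hg
    simpa only [add_sub_cancel] using h

end RadialChain

/-! ### Drift estimates -/

/-- A symmetric law on `[-1, 1]` with second moment `v`. -/
structure IsNoise (μ : Measure ℝ) (v : ℝ) : Prop where
  prob : IsProbabilityMeasure μ
  abs_le : ∀ᵐ s ∂μ, |s| ≤ 1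
  map_neg : μ.map (fun s => -s) = μ
  integral_sq : ∫ s, s ^ 2 ∂μ = v

lemma isNoise_coordLaw {d : ℕ} (hd : 2 ≤ d) : IsNoise (coordLaw d) (1 / d) :=
  ⟨isProbabilityMeasure_coordLaw hd, ae_coordLaw_abs_le hd, coordLaw_map_neg d,
    integral_sq_coordLaw hd⟩

namespace IsNoise

variable {μ : Measure ℝ} {v : ℝ}

lemma integrable (hμ : IsNoise μ v) {f : ℝ → ℝ} (hf : Measurable f) {C : ℝ}
    (hC : ∀ s, |s| ≤ 1 → |f s| ≤ C) : Integrable f μ := by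
  have := hμ.prob
  exact Integrable.of_bound hf.aestronglyMeasurable C
    (hμ.abs_le.mono fun s hs => hC s hs)

lemma integrable_quadratic (hμ : IsNoise μ v) (c₀ c₁ : ℝ) :
    Integrable (fun s => c₀ + c₁ * s ^ 2) μ := by
  refine hμ.integrable (by fun_prop) (C := |c₀| + |c₁|) fun s hs => ?_
  refine (abs_add_le _ _).trans ?_
  rw [abs_mul, abs_pow]
  have : |s| ^ 2 ≤ 1 := pow_le_one₀ (abs_nonneg _) hs
  nlinarith [abs_nonneg c₁]

lemma integral_quadratic (hμ : IsNoise μ v) (c₀ c₁ : ℝ) :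
    ∫ s, (c₀ + c₁ * s ^ 2) ∂μ = c₀ + c₁ * v := by
  have := hμ.prob
  rw [integral_add (integrable_const _) (by simpa using hμ.integrable_quadratic 0 c₁),
    integral_const_mul, hμ.integral_sq]
  simp

lemma integral_comp_neg (hμ : IsNoise μ v) {f : ℝ → ℝ} (hf : Measurable f) :
    ∫ s, f (-s) ∂μ = ∫ s, f s ∂μ := by
  conv_rhs => rw [← hμ.map_neg, integral_map measurable_neg.aemeasurable hf.aestronglyMeasurable]

/-- By symmetry `f` may be averaged with its reflection, which removes the odd terms. What remains
to be bounded is even, and a quadratic bound integrates exactly using only the second moment. -/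
lemma integral_le (hμ : IsNoise μ v) {f : ℝ → ℝ} (hf : Measurable f) {C : ℝ}
    (hC : ∀ s, |s| ≤ 1 → |f s| ≤ C) {c₀ c₁ : ℝ}
    (h : ∀ s, |s| ≤ 1 → f s + f (-s) ≤ 2 * (c₀ + c₁ * s ^ 2)) : ∫ s, f s ∂μ ≤ c₀ + c₁ * v := by
  have i1 := hμ.integrable hf hC
  have i2 : Integrable (fun s => f (-s)) μ :=
    hμ.integrable (hf.comp measurable_neg) (C := C) fun s hs => hC _ (by rwa [abs_neg])
  have h1 : ∫ s, (f s + f (-s)) ∂μ ≤ ∫ s, 2 * (c₀ + c₁ * s ^ 2) ∂μ :=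
    integral_mono_ae (i1.add i2) ((hμ.integrable_quadratic c₀ c₁).const_mul 2)
      (hμ.abs_le.mono fun s hs => h s hs)
  rw [integral_add i1 i2, hμ.integral_comp_neg hf, integral_const_mul,
    hμ.integral_quadratic] at h1
  linarith

lemma le_integral (hμ : IsNoise μ v) {f : ℝ → ℝ} (hf : Measurable f) {C : ℝ}
    (hC : ∀ s, |s| ≤ 1 → |f s| ≤ C) {c₀ c₁ : ℝ}
    (h : ∀ s, |s| ≤ 1 → 2 * (c₀ + c₁ * s ^ 2) ≤ f s + f (-s)) : c₀ + c₁ * v ≤ ∫ s, f s ∂μ := by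
  have := hμ.integral_le hf.neg (C := C) (fun s hs => by simpa using hC s hs)
    (c₀ := -c₀) (c₁ := -c₁) (fun s hs => by
      have := h s hs
      simp only [Pi.neg_apply]
      linarith)
  simp only [Pi.neg_apply, integral_neg] at this
  linarith

end IsNoise

/-! ### Moments of one radial step -/

lemma sq_le_one_of_abs_le {s : ℝ} (hs : |s| ≤ 1) : s ^ 2 ≤ 1 := by
  rw [← sq_abs]
  exact pow_le_one₀ (abs_nonneg _) hs

lemma radialStep_nonneg (p q r s : ℝ) : 0 ≤ radialStep p q r s := Real.sqrt_nonneg _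

lemma sq_radialStep {p q r s : ℝ} (hs : |s| ≤ 1) :
    radialStep p q r s ^ 2 = (r + p * s) ^ 2 + q ^ 2 * (1 - s ^ 2) := by
  have := sq_le_one_of_abs_le hs
  rw [radialStep, Real.sq_sqrt]
  have : 0 ≤ q ^ 2 * (1 - s ^ 2) := mul_nonneg (sq_nonneg _) (by linarith)
  positivity

lemma radialStep_le {p q r s : ℝ} (hp : 0 < p) (hq : 0 < q) (hr : 0 ≤ r) (hs : |s| ≤ 1) :
    radialStep p q r s ≤ r + (p + q) := by
  refine Real.sqrt_le_iff.2 ⟨by positivity, ?_⟩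
  have h1 := (abs_le.1 hs).2
  have h2 := (abs_le.1 hs).1
  have h3 : (r + p * s) ^ 2 ≤ (r + p) ^ 2 := by
    rw [sq_le_sq, abs_of_nonneg (by positivity : 0 ≤ r + p), abs_le]
    constructor <;> nlinarith
  nlinarith [mul_nonneg hr hq.le, mul_pos hp hq, mul_nonneg (sq_nonneg q) (sq_nonneg s)]

lemma integral_sq_radialStep_le {μ : Measure ℝ} {v : ℝ} (hμ : IsNoise μ v) {p q r : ℝ}
    (hp : 0 < p) (hq : 0 < q) (hr : 0 ≤ r) :
    ∫ s, radialStep p q r s ^ 2 ∂μ ≤ r ^ 2 + (p ^ 2 * v + q ^ 2 * (1 - v)) := by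
  have := hμ.integral_le (f := fun s => radialStep p q r s ^ 2)
    ((measurable_radialStep p q r).pow_const 2) (C := (r + (p + q)) ^ 2)
    (fun s hs => by
      rw [abs_of_nonneg (sq_nonneg _)]
      exact pow_le_pow_left₀ (radialStep_nonneg _ _ _ _) (radialStep_le hp hq hr hs) 2)
    (c₀ := r ^ 2 + q ^ 2) (c₁ := p ^ 2 - q ^ 2) (fun s hs => by
      rw [sq_radialStep hs, sq_radialStep (by rwa [abs_neg])]
      exact le_of_eq (by ring))
  linarith

lemma le_integral_radialStep {μ : Measure ℝ} {v : ℝ} (hμ : IsNoise μ v) {p q r : ℝ}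
    (hp : 0 < p) (hq : 0 < q) (hr : 0 ≤ r) :
    r + q ^ 2 * (1 - v) / (2 * (r + (p + q))) ≤ ∫ s, radialStep p q r s ∂μ := by
  have hc : 0 < r + (p + q) := by positivity
  -- With `h` the new radius, `h - (r + p s) = q² (1 - s²) / (h + r + p s)`, and the denominator is
  -- at most `2h ≤ 2 (r + p + q)`. The term `p s` is odd and drops out on averaging.
  have key : ∀ s, |s| ≤ 1 →
      r + p * s + q ^ 2 * (1 - s ^ 2) / (2 * (r + (p + q))) ≤ radialStep p q r s := by
    intro s hs
    have h1 := sq_radialStep (p := p) (q := q) (r := r) hs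
    have h2 := radialStep_le hp hq hr hs
    have h3 := radialStep_nonneg p q r s
    have h4 : 0 ≤ q ^ 2 * (1 - s ^ 2) :=
      mul_nonneg (sq_nonneg _) (by linarith [sq_le_one_of_abs_le hs])
    set h := radialStep p q r s
    have h5 : r + p * s ≤ h := by nlinarith
    rw [← le_sub_iff_add_le', div_le_iff₀ (by positivity)]
    have h6 : q ^ 2 * (1 - s ^ 2) = (h - (r + p * s)) * (h + (r + p * s)) := by linarith
    rw [h6]
    exact mul_le_mul_of_nonneg_left (by linarith) (by linarith)
  have := hμ.le_integral (f := fun s => radialStep p q r s)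
    (measurable_radialStep p q r) (C := r + (p + q))
    (fun s hs => by
      rw [abs_of_nonneg (radialStep_nonneg _ _ _ _)]
      exact radialStep_le hp hq hr hs)
    (c₀ := r + q ^ 2 / (2 * (r + (p + q)))) (c₁ := -(q ^ 2 / (2 * (r + (p + q))))) (fun s hs => by
      have h1 := key s hs
      have h2 := key (-s) (by rwa [abs_neg])
      refine le_trans (le_of_eq ?_) (add_le_add h1 h2)
      ring)
  refine le_trans (le_of_eq ?_) this
  ring

/-! ### Taylor bounds for the logarithm and for small negative powers -/

lemma log_one_add_le {t : ℝ} (ht : |t| ≤ 1 / 2) :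
    Real.log (1 + t) ≤ t - t ^ 2 / 2 + t ^ 3 / 3 + 2 * t ^ 4 := by
  have h := Real.abs_log_sub_add_sum_range_le (x := -t) (by rw [abs_neg]; linarith) 3
  simp only [Finset.sum_range_succ, Finset.sum_range_zero, abs_neg, sub_neg_eq_add] at h
  have h1 : |t| ^ (3 + 1) / (1 - |t|) ≤ 2 * t ^ 4 := by
    rw [div_le_iff₀ (by linarith), ← Even.pow_abs (by decide : Even 4) t]
    have h4 := mul_nonneg (pow_nonneg (abs_nonneg t) 4) (sub_nonneg.2 ht)
    have : |t| ^ (3 + 1) = |t| ^ 4 := rfl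
    linarith
  have h2 := (abs_le.1 (h.trans h1)).2
  norm_num at h2
  linarith [show (-t) ^ 3 = - t ^ 3 by ring]

lemma le_log_one_add {t : ℝ} (ht : |t| ≤ 1 / 2) :
    t - t ^ 2 / 2 - 2 * |t| * t ^ 2 ≤ Real.log (1 + t) := by
  have h := Real.abs_log_sub_add_sum_range_le (x := -t) (by rw [abs_neg]; linarith) 2
  simp only [Finset.sum_range_succ, Finset.sum_range_zero, abs_neg, sub_neg_eq_add] at h
  have h1 : |t| ^ (2 + 1) / (1 - |t|) ≤ 2 * |t| * t ^ 2 := by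
    rw [div_le_iff₀ (by linarith), ← sq_abs t]
    have h4 := mul_nonneg (pow_nonneg (abs_nonneg t) 3) (sub_nonneg.2 ht)
    have : |t| ^ (2 + 1) = |t| ^ 3 := rfl
    linarith
  have h2 := (abs_le.1 (h.trans h1)).1
  norm_num at h2
  linarith

lemma abs_log_one_add_le {t : ℝ} (ht : |t| ≤ 1 / 2) : |Real.log (1 + t)| ≤ 2 * |t| := by
  have h := Real.abs_log_sub_add_sum_range_le (x := -t) (by rw [abs_neg]; linarith) 1
  simp only [Finset.sum_range_succ, Finset.sum_range_zero, abs_neg, sub_neg_eq_add] at h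
  have h1 : |t| ^ (1 + 1) / (1 - |t|) ≤ |t| := by
    rw [div_le_iff₀ (by linarith)]
    have h4 := mul_nonneg (abs_nonneg t) (sub_nonneg.2 ht)
    have : |t| ^ (1 + 1) = |t| ^ 2 := rfl
    linarith
  have h2 := abs_le.1 (h.trans h1)
  norm_num at h2
  rw [abs_le]
  constructor <;> cases abs_cases t <;> linarith [h2.1, h2.2]

/-- The cubic remainder of the logarithm and the quadratic remainder of the exponential each cost at
most `ε / 8 * (ε / 2) * t ^ 2`. Together they account for the `ε` added to `1 / 2`. -/
lemma exp_neg_mul_log_one_add_le {ε t : ℝ} (hε : 0 < ε) (hε1 : ε ≤ 1) (ht : |t| ≤ ε / 4) :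
    Real.exp (-(ε / 8 * Real.log (1 + t))) ≤ 1 - ε / 8 * (t - (1 / 2 + ε) * t ^ 2) := by
  have ht2 : |t| ≤ 1 / 2 := by linarith
  have h1 := abs_log_one_add_le ht2
  have h2 := le_log_one_add ht2
  set l := Real.log (1 + t)
  have h3 : |-(ε / 8 * l)| ≤ 1 := by
    rw [abs_neg, abs_mul, abs_of_pos (by positivity : 0 < ε / 8)]
    nlinarith [abs_nonneg l]
  have h4 := (abs_le.1 (Real.abs_exp_sub_one_sub_id_le h3)).2
  have h5 : l ^ 2 ≤ 4 * t ^ 2 := by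
    rw [← sq_abs l, ← sq_abs t]
    nlinarith [abs_nonneg l]
  have h6 : |t| * t ^ 2 ≤ ε / 4 * t ^ 2 := mul_le_mul_of_nonneg_right ht (sq_nonneg _)
  have h7 : (ε / 8) * (t - t ^ 2 / 2 - 2 * (ε / 4 * t ^ 2)) ≤ ε / 8 * l :=
    mul_le_mul_of_nonneg_left (by linarith) (by positivity)
  have h8 : (-(ε / 8 * l)) ^ 2 ≤ ε / 8 * (ε / 8) * (4 * t ^ 2) := by
    rw [neg_sq, mul_pow, sq (ε / 8)]
    exact mul_le_mul_of_nonneg_left h5 (by positivity)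
  nlinarith

/-- Here `x` and `y` are the odd and even parts in `s` of the increment of `r²`. With `m = M / W`,
`(x / W)²` is `O(m)` and `y / W` is `O(m)`, and odd powers of `x` cancel in the sum. The error is
therefore `O(m²)`, the precision that the critical case needs. -/
lemma sum_log_one_add_le {x y W M : ℝ} (hW : 200 * M ≤ W) (hM : 0 < M) (hy : 0 ≤ y) (hyM : y ≤ M)
    (hx : x ^ 2 ≤ 8 * W * M) :
    |(x + y) / W| ≤ 1 / 2 ∧ Real.log (1 + (x + y) / W) + Real.log (1 + (-x + y) / W) ≤
      2 * (y / W - x ^ 2 / (2 * W ^ 2) + 300 * M ^ 2 / W ^ 2) := by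
  have hW0 : 0 < W := by linarith
  set ξ := x / W with hξ
  set η := y / W with hη
  set m := M / W with hm
  have e1 : (x + y) / W = ξ + η := by rw [add_div]
  have e2 : (-x + y) / W = -ξ + η := by rw [add_div, neg_div]
  have hm0 : 0 < m := by positivity
  have hm1 : m ≤ 1 / 200 := by rw [hm, div_le_iff₀ hW0]; linarith
  have hη0 : 0 ≤ η := by positivity
  have hη1 : η ≤ m := by rw [hη, hm]; gcongr
  have hξ2 : ξ ^ 2 ≤ 8 * m := by
    rw [hξ, hm, div_pow, div_le_iff₀ (by positivity)]
    calc x ^ 2 ≤ 8 * W * M := hx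
      _ = 8 * (M / W) * W ^ 2 := by field_simp
  have hξ1 : |ξ| ≤ 1 / 5 := abs_le_of_sq_le_sq (by linarith) (by norm_num)
  have hξ3 := abs_le.1 hξ1
  have ht1 : |ξ + η| ≤ 1 / 2 := by rw [abs_le]; constructor <;> linarith
  have ht2 : |-ξ + η| ≤ 1 / 2 := by rw [abs_le]; constructor <;> linarith
  rw [e1, e2]
  refine ⟨ht1, ?_⟩
  have h1 := log_one_add_le ht1
  have h2 := log_one_add_le ht2
  have e3 : x ^ 2 / (2 * W ^ 2) = ξ ^ 2 / 2 := by rw [hξ]; field_simp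
  have e4 : 300 * M ^ 2 / W ^ 2 = 300 * m ^ 2 := by rw [hm]; field_simp
  rw [e3, e4]
  have hζ0 := sq_nonneg ξ
  have a1 : ξ ^ 2 * η ≤ 8 * m * m := mul_le_mul hξ2 hη1 hη0 (by positivity)
  have a2 : ξ ^ 2 * ξ ^ 2 ≤ 8 * m * (8 * m) := mul_le_mul hξ2 hξ2 hζ0 (by positivity)
  have a3 : η ^ 2 ≤ m ^ 2 := pow_le_pow_left₀ hη0 hη1 2
  have hη2 : η ≤ 1 := by linarith
  have a4 : η ^ 3 ≤ η ^ 2 := pow_le_pow_of_le_one hη0 hη2 (by norm_num)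
  have a5 : η ^ 4 ≤ η ^ 2 := pow_le_pow_of_le_one hη0 hη2 (by norm_num)
  have a6 : ξ ^ 2 * η ^ 2 ≤ 8 * m * m :=
    mul_le_mul hξ2 (by nlinarith) (sq_nonneg _) (by positivity)
  have e5 : ((ξ + η) - (ξ + η) ^ 2 / 2 + (ξ + η) ^ 3 / 3 + 2 * (ξ + η) ^ 4) +
      ((-ξ + η) - (-ξ + η) ^ 2 / 2 + (-ξ + η) ^ 3 / 3 + 2 * (-ξ + η) ^ 4) =
      2 * (η - ξ ^ 2 / 2 - η ^ 2 / 2 + ξ ^ 2 * η + η ^ 3 / 3 +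
        2 * (ξ ^ 2 * ξ ^ 2 + 6 * (ξ ^ 2 * η ^ 2) + η ^ 4)) := by ring
  have a7 : 0 ≤ m * m := by positivity
  have e6 : m ^ 2 = m * m := sq m
  rw [e6] at a3 ⊢
  linarith

/-! ### Lyapunov functions for the two regimes -/

/-- The radial drift of `log (r² - C)` is not positive far out, in the recurrent regime. -/
lemma exists_integral_log_le {μ : Measure ℝ} {v : ℝ} (hμ : IsNoise μ v) (hv : 0 < v) {p q : ℝ}
    (hp : 0 < p) (hq : 0 < q) (h : q ^ 2 * (1 - v) ≤ p ^ 2 * v) :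
    ∃ C r₁ : ℝ, 0 < r₁ ∧ ∀ r, r₁ ≤ r → 1 ≤ r ^ 2 - C ∧
      ∫ s, Real.log (max (radialStep p q r s ^ 2 - C) 1) ∂μ ≤ Real.log (r ^ 2 - C) := by
  set M := p ^ 2 + q ^ 2 with hM
  have hM0 : 0 < M := by positivity
  have hpv : 0 < p ^ 2 * v := by positivity
  -- Chosen so that `2 C p² v` equals the error constant `300 M²`.
  set C := 300 * M ^ 2 / (2 * (p ^ 2 * v)) with hC
  have hC0 : 0 < C := by positivity
  -- As `r ≤ r²`, this radius gives `W ≥ C + 200 M + 2`. Hence the expansion applies, `r² ≤ 2 W`,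
  -- and, the relative increment being at least `-1/2`, the truncation at `1` is inactive after one
  -- step.
  refine ⟨C, C + (C + 200 * M + 2), by positivity, fun r hr => ?_⟩
  have hr1 : 1 ≤ r := by linarith
  have hr2 : r ≤ r ^ 2 := by nlinarith
  set W := r ^ 2 - C with hW
  have hW1 : C + 200 * M + 2 ≤ W := by linarith
  have hW0 : 0 < W := by linarith
  refine ⟨by linarith, ?_⟩
  have hstep : ∀ s, |s| ≤ 1 →
      |(2 * r * p * s + (p ^ 2 * s ^ 2 + q ^ 2 * (1 - s ^ 2))) / W| ≤ 1 / 2 ∧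
      Real.log (1 + (2 * r * p * s + (p ^ 2 * s ^ 2 + q ^ 2 * (1 - s ^ 2))) / W) +
        Real.log (1 + (-(2 * r * p * s) + (p ^ 2 * s ^ 2 + q ^ 2 * (1 - s ^ 2))) / W) ≤
      2 * ((p ^ 2 * s ^ 2 + q ^ 2 * (1 - s ^ 2)) / W - (2 * r * p * s) ^ 2 / (2 * W ^ 2) +
        300 * M ^ 2 / W ^ 2) := by
    intro s hs
    have hs2 := sq_le_one_of_abs_le hs
    have hs0 := sq_nonneg s
    have b1 : 0 ≤ p ^ 2 * s ^ 2 := by positivity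
    have b2 : 0 ≤ q ^ 2 * (1 - s ^ 2) := mul_nonneg (sq_nonneg _) (by linarith)
    have b3 : p ^ 2 * s ^ 2 ≤ p ^ 2 := by nlinarith [sq_nonneg p]
    have b4 : q ^ 2 * (1 - s ^ 2) ≤ q ^ 2 := by nlinarith [sq_nonneg q]
    refine sum_log_one_add_le (by linarith) hM0 (by linarith) (by linarith) ?_
    have b5 : r ^ 2 ≤ 2 * W := by linarith
    have b6 : p ^ 2 * s ^ 2 ≤ M := by nlinarith
    calc (2 * r * p * s) ^ 2 = 4 * (r ^ 2 * (p ^ 2 * s ^ 2)) := by ring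
      _ ≤ 4 * (2 * W * M) := by gcongr
      _ = 8 * W * M := by ring
  have hlog : ∀ s, |s| ≤ 1 → Real.log (max (radialStep p q r s ^ 2 - C) 1) =
      Real.log W +
        Real.log (1 + (2 * r * p * s + (p ^ 2 * s ^ 2 + q ^ 2 * (1 - s ^ 2))) / W) := by
    intro s hs
    have ht := (abs_le.1 (hstep s hs).1).1
    set t := (2 * r * p * s + (p ^ 2 * s ^ 2 + q ^ 2 * (1 - s ^ 2))) / W with ht'
    have e : radialStep p q r s ^ 2 - C = W * (1 + t) := by
      rw [sq_radialStep hs, ht', mul_add, mul_div_cancel₀ _ hW0.ne', hW]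
      ring
    rw [e, max_eq_left (by nlinarith), Real.log_mul hW0.ne' (by linarith)]
  have hint := hμ.integral_le (f := fun s => Real.log (max (radialStep p q r s ^ 2 - C) 1))
    (Real.measurable_log.comp ((((measurable_radialStep p q r).pow_const 2).sub_const C).max
      measurable_const)) (C := |Real.log W| + 1)
    (fun s hs => by
      rw [hlog s hs]
      refine (abs_add_le _ _).trans ?_
      have := abs_log_one_add_le (hstep s hs).1
      linarith [(hstep s hs).1])
    (c₀ := Real.log W + q ^ 2 / W + 300 * M ^ 2 / W ^ 2)
    (c₁ := (p ^ 2 - q ^ 2) / W - 2 * r ^ 2 * p ^ 2 / W ^ 2)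
    (fun s hs => by
      rw [hlog s hs, hlog (-s) (by rwa [abs_neg])]
      have := (hstep s hs).2
      have e2 : 2 * r * p * -s = -(2 * r * p * s) := by ring
      rw [e2, neg_sq]
      refine le_trans (b := 2 * Real.log W + 2 * ((p ^ 2 * s ^ 2 + q ^ 2 * (1 - s ^ 2)) / W -
        (2 * r * p * s) ^ 2 / (2 * W ^ 2) + 300 * M ^ 2 / W ^ 2)) (by linarith) (le_of_eq ?_)
      field_simp
      ring)
  refine hint.trans ?_
  have e3 : Real.log W + q ^ 2 / W + 300 * M ^ 2 / W ^ 2 +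
      ((p ^ 2 - q ^ 2) / W - 2 * r ^ 2 * p ^ 2 / W ^ 2) * v = Real.log W +
      ((q ^ 2 * (1 - v) + p ^ 2 * v) * W - 2 * r ^ 2 * (p ^ 2 * v) + 300 * M ^ 2) / W ^ 2 := by
    field_simp
    ring
  rw [e3]
  have e4 : 300 * M ^ 2 = 2 * C * (p ^ 2 * v) := by
    rw [hC]
    field_simp
  have : ((q ^ 2 * (1 - v) + p ^ 2 * v) * W - 2 * r ^ 2 * (p ^ 2 * v) + 300 * M ^ 2) / W ^ 2
      ≤ 0 := by
    refine div_nonpos_of_nonpos_of_nonneg ?_ (by positivity)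
    -- Writing `r² = W + C` produces a term `-2 C p² v` that cancels the error exactly, leaving `(q²
    -- (1 - v) - p² v) W ≤ 0`.
    rw [e4, show r ^ 2 = W + C by rw [hW]; ring]
    nlinarith [mul_le_mul_of_nonneg_right h hW0.le]
  linarith

/-- A small negative power of the distance has non-positive drift far out, in the transient
regime. -/
lemma exists_integral_exp_le {μ : Measure ℝ} {v : ℝ} (hμ : IsNoise μ v) (hv : 0 < v) {p q : ℝ}
    (hp : 0 < p) (hq : 0 < q) (h : p ^ 2 * v < q ^ 2 * (1 - v)) :
    ∃ κ r₁ : ℝ, 0 < κ ∧ 1 ≤ r₁ ∧ ∀ r, r₁ ≤ r →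
      (∀ s, |s| ≤ 1 → 0 < radialStep p q r s) ∧
      Integrable (fun s => Real.exp (-(κ * Real.log (radialStep p q r s ^ 2)))) μ ∧
      ∫ s, Real.exp (-(κ * Real.log (radialStep p q r s ^ 2))) ∂μ ≤
        Real.exp (-(κ * Real.log (r ^ 2))) := by
  set M := p ^ 2 + q ^ 2 with hM
  have hM0 : 0 < M := by positivity
  have hpv : 0 < p ^ 2 * v := by positivity
  set m := p ^ 2 * v + q ^ 2 * (1 - v) with hm
  -- Here `m - 2 p² v = q² (1 - v) - p² v` is the slack in the hypothesis. This `ε` ensures `(1/2 +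
  -- ε) (4 p² v + ε) ≤ m`, the sign condition needed at the end.
  set ε := min 1 ((m - 2 * (p ^ 2 * v)) / (2 + 4 * (p ^ 2 * v))) with hε
  have hε0 : 0 < ε := lt_min one_pos (div_pos (by linarith) (by positivity))
  have hε1 : ε ≤ 1 := min_le_left _ _
  have hε2 : ε * (2 + 4 * (p ^ 2 * v)) ≤ m - 2 * (p ^ 2 * v) := by
    rw [← le_div_iff₀ (by positivity)]
    exact min_le_right _ _
  -- The term `256 M / ε²` keeps the relative increment of `r²` within `ε / 4`; the term `M² / ε`
  -- makes the square of the even part at most `ε r²`.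
  refine ⟨ε / 8, 1 + 256 * M / ε ^ 2 + M ^ 2 / ε, by positivity, ?_, fun r hr => ?_⟩
  · have : 0 ≤ 256 * M / ε ^ 2 + M ^ 2 / ε := by positivity
    linarith
  have c1 : 0 ≤ 256 * M / ε ^ 2 := by positivity
  have c2 : 0 ≤ M ^ 2 / ε := by positivity
  have hr1 : 1 ≤ r := by linarith
  have hr2 : r ≤ r ^ 2 := by nlinarith
  set V := r ^ 2 with hV
  have hV0 : 0 < V := by linarith
  have hV1 : 256 * M ≤ V * ε ^ 2 := by
    rw [← div_le_iff₀ (by positivity)]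
    linarith
  have hV2 : M ^ 2 ≤ V * ε := by
    rw [← div_le_iff₀ (by positivity)]
    linarith
  have hy : ∀ s, |s| ≤ 1 → 0 ≤ p ^ 2 * s ^ 2 + q ^ 2 * (1 - s ^ 2) ∧
      p ^ 2 * s ^ 2 + q ^ 2 * (1 - s ^ 2) ≤ M ∧ p ^ 2 * s ^ 2 ≤ M := by
    intro s hs
    have hs2 := sq_le_one_of_abs_le hs
    have hs0 := sq_nonneg s
    have b1 : 0 ≤ p ^ 2 * s ^ 2 := by positivity
    have b2 : 0 ≤ q ^ 2 * (1 - s ^ 2) := mul_nonneg (sq_nonneg _) (by linarith)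
    have b3 : p ^ 2 * s ^ 2 ≤ p ^ 2 := by nlinarith [sq_nonneg p]
    have b4 : q ^ 2 * (1 - s ^ 2) ≤ q ^ 2 := by nlinarith [sq_nonneg q]
    refine ⟨by linarith, by linarith, by nlinarith⟩
  set T : ℝ → ℝ := fun s =>
    (2 * r * p * s + (p ^ 2 * s ^ 2 + q ^ 2 * (1 - s ^ 2))) / V with hT
  have hTε : ∀ s, |s| ≤ 1 → |T s| ≤ ε / 4 := by
    intro s hs
    obtain ⟨y0, y1, y2⟩ := hy s hs
    have d1 : |2 * r * p * s| ≤ ε / 8 * V := by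
      refine abs_le_of_sq_le_sq ?_ (by positivity)
      calc (2 * r * p * s) ^ 2 = 4 * V * (p ^ 2 * s ^ 2) := by rw [hV]; ring
        _ ≤ 4 * V * M := by gcongr
        _ ≤ (ε / 8 * V) ^ 2 := by nlinarith
    have d2 : M ≤ ε / 8 * V := by nlinarith
    rw [hT]
    simp only
    rw [abs_div, abs_of_pos hV0, div_le_iff₀ hV0]
    refine (abs_add_le _ _).trans ?_
    rw [abs_of_nonneg y0]
    linarith
  have hstep : ∀ s, |s| ≤ 1 → radialStep p q r s ^ 2 = V * (1 + T s) := by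
    intro s hs
    rw [sq_radialStep hs, hT]
    simp only
    rw [mul_add, mul_div_cancel₀ _ hV0.ne', hV]
    ring
  have hT1 : ∀ s, |s| ≤ 1 → 0 < 1 + T s := fun s hs => by
    linarith [(abs_le.1 (hTε s hs)).1]
  have hexp : ∀ s, |s| ≤ 1 → Real.exp (-(ε / 8 * Real.log (radialStep p q r s ^ 2))) =
      Real.exp (-(ε / 8 * Real.log V)) * Real.exp (-(ε / 8 * Real.log (1 + T s))) := by
    intro s hs
    rw [hstep s hs, Real.log_mul hV0.ne' (hT1 s hs).ne', ← Real.exp_add]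
    ring_nf
  set A := Real.exp (-(ε / 8 * Real.log V)) with hA
  have hA0 : 0 < A := Real.exp_pos _
  have hmeas : Measurable fun s => Real.exp (-(ε / 8 * Real.log (radialStep p q r s ^ 2))) :=
    Real.measurable_exp.comp ((Real.measurable_log.comp
      ((measurable_radialStep p q r).pow_const 2)).const_mul _).neg
  have hbd : ∀ s, |s| ≤ 1 →
      |Real.exp (-(ε / 8 * Real.log (radialStep p q r s ^ 2)))| ≤ A * 3 := by
    intro s hs
    rw [abs_of_pos (Real.exp_pos _), hexp s hs]
    refine mul_le_mul_of_nonneg_left ?_ hA0.le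
    refine (exp_neg_mul_log_one_add_le hε0 hε1 (hTε s hs)).trans ?_
    obtain ⟨t1, t2⟩ := abs_le.1 (hTε s hs)
    have t3 : T s ^ 2 ≤ 1 := sq_le_one_of_abs_le (by linarith [hTε s hs])
    have t4 : -2 ≤ T s - (1 / 2 + ε) * T s ^ 2 := by
      have := mul_le_mul (by linarith : 1 / 2 + ε ≤ 3 / 2) t3 (sq_nonneg _) (by norm_num)
      linarith
    have t5 := mul_le_mul_of_nonneg_left t4 (by positivity : 0 ≤ ε / 8)
    linarith
  refine ⟨fun s hs => ?_, hμ.integrable hmeas hbd, ?_⟩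
  · refine lt_of_le_of_ne (radialStep_nonneg _ _ _ _) fun h0 => ?_
    have h1 := hstep s hs
    rw [← h0, zero_pow two_ne_zero] at h1
    exact (mul_pos hV0 (hT1 s hs)).ne h1
  have hint := hμ.integral_le hmeas hbd
    (c₀ := A * (1 - ε / 8 / V * (q ^ 2 - (1 / 2 + ε) * ε)))
    (c₁ := A * (-(ε / 8 / V * (p ^ 2 - q ^ 2 - (1 / 2 + ε) * (4 * p ^ 2)))))
    (fun s hs => by
      have hs' : |-s| ≤ 1 := by rwa [abs_neg]
      rw [hexp s hs, hexp (-s) hs', ← mul_add]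
      have k1 := exp_neg_mul_log_one_add_le hε0 hε1 (hTε s hs)
      have k2 := exp_neg_mul_log_one_add_le hε0 hε1 (hTε (-s) hs')
      rw [show 2 * (A * (1 - ε / 8 / V * (q ^ 2 - (1 / 2 + ε) * ε)) +
        A * (-(ε / 8 / V * (p ^ 2 - q ^ 2 - (1 / 2 + ε) * (4 * p ^ 2)))) * s ^ 2) =
        A * (2 * (1 - ε / 8 * ((p ^ 2 * s ^ 2 + q ^ 2 * (1 - s ^ 2)) / V -
          (1 / 2 + ε) * ((4 * p ^ 2 * s ^ 2 + ε) / V)))) by field_simp; ring]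
      refine mul_le_mul_of_nonneg_left ?_ hA0.le
      obtain ⟨y0, y1, y2⟩ := hy s hs
      have k3 : T s + T (-s) = 2 * ((p ^ 2 * s ^ 2 + q ^ 2 * (1 - s ^ 2)) / V) := by
        simp only [hT]
        field_simp
        ring
      have k4 : T s ^ 2 + T (-s) ^ 2 ≤ 2 * ((4 * p ^ 2 * s ^ 2 + ε) / V) := by
        have : T s ^ 2 + T (-s) ^ 2 = 2 * ((4 * p ^ 2 * s ^ 2) * V +
            (p ^ 2 * s ^ 2 + q ^ 2 * (1 - s ^ 2)) ^ 2) / V ^ 2 := by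
          simp only [hT, hV]
          field_simp
          ring
        rw [this, div_le_iff₀ (by positivity)]
        have k5 : (p ^ 2 * s ^ 2 + q ^ 2 * (1 - s ^ 2)) ^ 2 ≤ V * ε :=
          (pow_le_pow_left₀ y0 y1 2).trans hV2
        calc 2 * ((4 * p ^ 2 * s ^ 2) * V + (p ^ 2 * s ^ 2 + q ^ 2 * (1 - s ^ 2)) ^ 2)
            ≤ 2 * ((4 * p ^ 2 * s ^ 2) * V + V * ε) := by gcongr
          _ = 2 * ((4 * p ^ 2 * s ^ 2 + ε) / V) * V ^ 2 := by field_simp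
      have k6 : ε / 8 * ((1 / 2 + ε) * (T s ^ 2 + T (-s) ^ 2)) ≤
          ε / 8 * ((1 / 2 + ε) * (2 * ((4 * p ^ 2 * s ^ 2 + ε) / V))) := by gcongr
      have k7 : ε / 8 * (T s + T (-s)) =
        ε / 8 * (2 * ((p ^ 2 * s ^ 2 + q ^ 2 * (1 - s ^ 2)) / V)) := by rw [k3]
      linarith)
  refine hint.trans ?_
  have e5 : A * (1 - ε / 8 / V * (q ^ 2 - (1 / 2 + ε) * ε)) +
      A * (-(ε / 8 / V * (p ^ 2 - q ^ 2 - (1 / 2 + ε) * (4 * p ^ 2)))) * v =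
      A - A * (ε / 8 / V) * (m - (1 / 2 + ε) * (4 * (p ^ 2 * v) + ε)) := by
    rw [hm]
    ring
  rw [e5]
  have : 0 ≤ A * (ε / 8 / V) * (m - (1 / 2 + ε) * (4 * (p ^ 2 * v) + ε)) := by
    refine mul_nonneg (by positivity) ?_
    nlinarith
  linarith

/-! ### Nullity of the radial chain -/

namespace IsRadialChain

section Visits

variable {Ω : Type*} {R : ℕ → Ω → ℝ}

/-- The number of visits to `[0, L]` before time `n`. -/
noncomputable def visits (R : ℕ → Ω → ℝ) (L : ℝ) (n : ℕ) (ω : Ω) : ℝ :=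
  ∑ k ∈ Finset.range n, {ω | R k ω ≤ L}.indicator (fun _ => (1 : ℝ)) ω

lemma visits_nonneg (L : ℝ) (n : ℕ) (ω : Ω) : 0 ≤ visits R L n ω :=
  Finset.sum_nonneg fun _ _ => Set.indicator_nonneg (fun _ _ => zero_le_one) _

lemma visits_mono (L : ℝ) (ω : Ω) : Monotone fun n => visits R L n ω := fun _ _ h =>
  Finset.sum_le_sum_of_subset_of_nonneg (Finset.range_mono h)
    fun _ _ _ => Set.indicator_nonneg (fun _ _ => zero_le_one) _

lemma visits_le (L : ℝ) (n : ℕ) (ω : Ω) : visits R L n ω ≤ n := by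
  refine (Finset.sum_le_card_nsmul _ _ 1 fun k _ => ?_).trans (by simp)
  exact Set.indicator_apply_le' (fun _ => le_rfl) fun _ => zero_le_one

end Visits

variable {Ω : Type*} [mΩ : MeasurableSpace Ω] {P : Measure Ω}
  {ℱ : Filtration ℕ mΩ} {p q v : ℝ} {μ : Measure ℝ} {R : ℕ → Ω → ℝ}

lemma measurable (hR : IsRadialChain P ℱ p q μ R) (n : ℕ) : Measurable (R n) :=
  (hR.adapted n).mono (ℱ.le n) le_rfl

lemma measurable_visits (hR : IsRadialChain P ℱ p q μ R) (L : ℝ) (n : ℕ) :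
    Measurable (visits R L n) :=
  Finset.measurable_sum _ fun k _ =>
    measurable_const.indicator (measurableSet_le (hR.measurable k) measurable_const)

/-- Steps outward are at most `p + q`, so the chain is essentially bounded at each fixed time. All
integrability of continuous functions of the chain rests on this. -/
lemma ae_le (hR : IsRadialChain P ℱ p q μ R) (hμ : IsNoise μ v) (hp : 0 < p) (hq : 0 < q)
    (n : ℕ) : ∃ c, ∀ᵐ ω ∂P, R n ω ≤ c := by
  induction n with
  | zero => exact hR.start
  | succ n ih =>
    obtain ⟨c, hc⟩ := ih
    refine ⟨c + (p + q), ?_⟩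
    have h := hR.step n Set.univ MeasurableSet.univ
      ((Set.Ioi (c + (p + q))).indicator fun _ => 1) (measurable_const.indicator measurableSet_Ioi)
    have h0 : ∫⁻ ω in Set.univ, ∫⁻ s, (Set.Ioi (c + (p + q))).indicator (fun _ => (1 : ℝ≥0∞))
        (radialStep p q (R n ω) s) ∂μ ∂P = 0 := by
      rw [Measure.restrict_univ]
      refine (lintegral_congr_ae ?_).trans lintegral_zero
      filter_upwards [hc] with ω hω
      refine (lintegral_congr_ae ?_).trans lintegral_zero
      filter_upwards [hμ.abs_le] with s hs
      refine Set.indicator_of_notMem ?_ _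
      have := radialStep_le hp hq (hR.nonneg n ω) hs
      simp only [Set.mem_Ioi, not_lt]
      linarith
    have hg : Measurable fun ω => (Set.Ioi (c + (p + q))).indicator (fun _ => (1 : ℝ≥0∞))
        (R (n + 1) ω) :=
      (measurable_const.indicator measurableSet_Ioi).comp (hR.measurable _)
    rw [h0, Measure.restrict_univ, lintegral_eq_zero_iff hg] at h
    filter_upwards [h] with ω hω
    by_contra! hlt
    have : R (n + 1) ω ∈ Set.Ioi (c + (p + q)) := hlt
    simp [this] at hω

lemma integrable_radialStep (hμ : IsNoise μ v) (hp : 0 < p) (hq : 0 < q) {G : ℝ → ℝ}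
    (hG : Continuous G) {r : ℝ} (hr : 0 ≤ r) : Integrable (fun s => G (radialStep p q r s)) μ := by
  obtain ⟨C, hC⟩ := (isCompact_Icc (a := (0 : ℝ)) (b := r + (p + q))).exists_bound_of_continuousOn
    hG.continuousOn
  exact hμ.integrable (hG.measurable.comp (measurable_radialStep p q r)) fun s hs =>
    hC _ ⟨radialStep_nonneg _ _ _ _, radialStep_le hp hq hr hs⟩

lemma setIntegral_succ (hR : IsRadialChain P ℱ p q μ R) (hμ : IsNoise μ v) (hp : 0 < p)
    (hq : 0 < q) {G : ℝ → ℝ} (hG : Continuous G) (hG0 : ∀ x, 0 ≤ G x) {n : ℕ} {E : Set Ω}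
    (hE : MeasurableSet[ℱ n] E) :
    ∫ ω in E, G (R (n + 1) ω) ∂P = ∫ ω in E, ∫ s, G (radialStep p q (R n ω) s) ∂μ ∂P := by
  have := hμ.prob
  have hm : Measurable fun r => ∫ s, G (radialStep p q r s) ∂μ :=
    (StronglyMeasurable.integral_prod_right (f := fun r s => G (radialStep p q r s))
      (hG.comp (continuous_radialStep p q)).stronglyMeasurable).measurable
  rw [integral_eq_lintegral_of_nonneg_ae (Eventually.of_forall fun ω => hG0 _)
      (hG.measurable.comp (hR.measurable _)).aestronglyMeasurable,
    integral_eq_lintegral_of_nonneg_ae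
      (Eventually.of_forall fun ω => integral_nonneg fun s => hG0 _)
      (hm.comp (hR.measurable _)).aestronglyMeasurable,
    hR.step n E hE (fun x => ENNReal.ofReal (G x)) (ENNReal.measurable_ofReal.comp hG.measurable)]
  congr 1
  refine lintegral_congr fun ω => ?_
  rw [ofReal_integral_eq_lintegral_ofReal
    (integrable_radialStep hμ hp hq hG (hR.nonneg n ω)) (Eventually.of_forall fun s => hG0 _)]

variable [IsProbabilityMeasure P]

lemma integrable_comp (hR : IsRadialChain P ℱ p q μ R) (hμ : IsNoise μ v) (hp : 0 < p)
    (hq : 0 < q) {G : ℝ → ℝ} (hG : Continuous G) (n : ℕ) : Integrable (fun ω => G (R n ω)) P := by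
  obtain ⟨c, hc⟩ := hR.ae_le hμ hp hq n
  obtain ⟨C, hC⟩ := (isCompact_Icc (a := (0 : ℝ)) (b := c)).exists_bound_of_continuousOn
    hG.continuousOn
  refine Integrable.of_bound (hG.measurable.comp (hR.measurable n)).aestronglyMeasurable C ?_
  filter_upwards [hc] with ω hω
  exact hC _ ⟨hR.nonneg n ω, hω⟩

lemma integrable_drift (hR : IsRadialChain P ℱ p q μ R) (hμ : IsNoise μ v) (hp : 0 < p)
    (hq : 0 < q) {G : ℝ → ℝ} (hG : Continuous G) (n : ℕ) :
    Integrable (fun ω => ∫ s, G (radialStep p q (R n ω) s) ∂μ) P := by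
  have := hμ.prob
  have hm : Measurable fun r => ∫ s, G (radialStep p q r s) ∂μ :=
    (StronglyMeasurable.integral_prod_right (f := fun r s => G (radialStep p q r s))
      (hG.comp (continuous_radialStep p q)).stronglyMeasurable).measurable
  obtain ⟨c, hc⟩ := hR.ae_le hμ hp hq n
  obtain ⟨C, hC⟩ := (isCompact_Icc (a := (0 : ℝ)) (b := c + (p + q))).exists_bound_of_continuousOn
    hG.continuousOn
  refine Integrable.of_bound (hm.comp (hR.measurable n)).aestronglyMeasurable C ?_
  filter_upwards [hc] with ω hω
  refine (norm_integral_le_of_norm_le_const (C := C) ?_).trans (by simp)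
  filter_upwards [hμ.abs_le] with s hs
  exact hC _ ⟨radialStep_nonneg _ _ _ _,
    (radialStep_le hp hq (hR.nonneg n ω) hs).trans (by linarith)⟩

lemma setIntegral_succ_le (hR : IsRadialChain P ℱ p q μ R) (hμ : IsNoise μ v) (hp : 0 < p)
    (hq : 0 < q) {G : ℝ → ℝ} (hG : Continuous G) (hG0 : ∀ x, 0 ≤ G x) {n : ℕ} {E : Set Ω}
    (hE : MeasurableSet[ℱ n] E)
    (h : ∀ ω ∈ E, ∫ s, G (radialStep p q (R n ω) s) ∂μ ≤ G (R n ω)) :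
    ∫ ω in E, G (R (n + 1) ω) ∂P ≤ ∫ ω in E, G (R n ω) ∂P := by
  rw [hR.setIntegral_succ hμ hp hq hG hG0 hE]
  exact setIntegral_mono_on (hR.integrable_drift hμ hp hq hG n).integrableOn
    (hR.integrable_comp hμ hp hq hG n).integrableOn (ℱ.le n _ hE) h

lemma integral_sq_le (hR : IsRadialChain P ℱ p q μ R) (hμ : IsNoise μ v) (hp : 0 < p)
    (hq : 0 < q) (n : ℕ) :
    ∫ ω, R n ω ^ 2 ∂P ≤ ∫ ω, R 0 ω ^ 2 ∂P + (p ^ 2 * v + q ^ 2 * (1 - v)) * n := by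
  induction n with
  | zero => simp
  | succ n ih =>
    have h := hR.setIntegral_succ hμ hp hq (G := fun x => x ^ 2) (by fun_prop)
      (fun x => sq_nonneg x) (n := n) MeasurableSet.univ
    rw [Measure.restrict_univ] at h
    have i1 := hR.integrable_comp hμ hp hq (G := fun x => x ^ 2) (by fun_prop) n
    have h1 : ∫ ω, ∫ s, radialStep p q (R n ω) s ^ 2 ∂μ ∂P ≤
        ∫ ω, (R n ω ^ 2 + (p ^ 2 * v + q ^ 2 * (1 - v))) ∂P :=
      integral_mono (hR.integrable_drift hμ hp hq (G := fun x => x ^ 2) (by fun_prop) n)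
        (i1.add (integrable_const _)) fun ω => integral_sq_radialStep_le hμ hp hq (hR.nonneg n ω)
    rw [integral_add i1 (integrable_const _)] at h1
    simp only [integral_const, probReal_univ, one_smul] at h1
    push_cast
    linarith

/-- The conditional mean increment of `R` is non-negative everywhere and at least `q² (1 - v) / (2
(L + p + q))` on `{R ≤ L}`. `K` is the reciprocal of that amount, and the right-hand side telescopes
over `n`. -/
lemma exists_measure_le_le (hR : IsRadialChain P ℱ p q μ R) (hμ : IsNoise μ v) (hv : v < 1)
    (hp : 0 < p) (hq : 0 < q) {L : ℝ} (hL : 0 ≤ L) :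
    ∃ K, 0 ≤ K ∧ ∀ n, P.real {ω | R n ω ≤ L} ≤ K * (∫ ω, R (n + 1) ω ∂P - ∫ ω, R n ω ∂P) := by
  have hδ : 0 < q ^ 2 * (1 - v) := mul_pos (by positivity) (by linarith)
  refine ⟨2 * (L + (p + q)) / (q ^ 2 * (1 - v)), by positivity, fun n => ?_⟩
  -- The test function must be non-negative on all of `ℝ`, hence `|x|` in place of `x`.
  have h := hR.setIntegral_succ hμ hp hq (G := fun x => |x|) (by fun_prop)
    (fun x => abs_nonneg x) (n := n) MeasurableSet.univ
  rw [Measure.restrict_univ] at h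
  simp only [abs_of_nonneg (hR.nonneg _ _), abs_of_nonneg (radialStep_nonneg _ _ _ _)] at h
  have i1 := hR.integrable_comp hμ hp hq (G := fun x => x) (by fun_prop) n
  have i2 := hR.integrable_drift hμ hp hq (G := fun x => x) (by fun_prop) n
  have hmeas : MeasurableSet {ω | R n ω ≤ L} := measurableSet_le (hR.measurable n) measurable_const
  rw [h, ← integral_sub i2 i1, ← integral_const_mul, ← integral_indicator_one hmeas]
  refine integral_mono ((integrable_const _).indicator hmeas) ((i2.sub i1).const_mul _) fun ω => ?_
  have hd := le_integral_radialStep hμ hp hq (hR.nonneg n ω)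
  have hr := hR.nonneg n ω
  have hd0 : 0 ≤ q ^ 2 * (1 - v) / (2 * (R n ω + (p + q))) := by positivity
  by_cases hω : R n ω ≤ L
  · have hv0 : 0 < 1 - v := by linarith
    rw [Set.indicator_of_mem (by exact hω), Pi.one_apply]
    have : q ^ 2 * (1 - v) / (2 * (L + (p + q))) ≤ q ^ 2 * (1 - v) / (2 * (R n ω + (p + q))) := by
      gcongr
    calc (1 : ℝ) = 2 * (L + (p + q)) / (q ^ 2 * (1 - v)) *
          (q ^ 2 * (1 - v) / (2 * (L + (p + q)))) := by field_simp
      _ ≤ _ := mul_le_mul_of_nonneg_left (by linarith) (by positivity)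
  · rw [Set.indicator_of_notMem (by exact hω)]
    exact mul_nonneg (by positivity) (by linarith)

lemma integral_visits_le (hR : IsRadialChain P ℱ p q μ R) (hμ : IsNoise μ v) (hv : v < 1)
    (hp : 0 < p) (hq : 0 < q) {L : ℝ} (hL : 0 ≤ L) :
    ∃ D, 0 ≤ D ∧ ∀ k : ℕ, ∫ ω, visits R L (4 ^ k) ω ∂P ≤ D * 2 ^ k := by
  obtain ⟨K, hK, h⟩ := hR.exists_measure_le_le hμ hv hp hq hL
  have h1 : ∀ n, ∫ ω, visits R L n ω ∂P ≤ K * ∫ ω, R n ω ∂P := by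
    intro n
    have hmeas : ∀ k, MeasurableSet {ω | R k ω ≤ L} := fun k =>
      measurableSet_le (hR.measurable k) measurable_const
    unfold visits
    rw [integral_finsetSum _ fun k _ => (integrable_const _).indicator (hmeas k)]
    calc ∑ k ∈ Finset.range n, ∫ ω, {ω | R k ω ≤ L}.indicator (fun _ => (1 : ℝ)) ω ∂P
        = ∑ k ∈ Finset.range n, P.real {ω | R k ω ≤ L} :=
          Finset.sum_congr rfl fun k _ => integral_indicator_one (hmeas k)
      _ ≤ ∑ k ∈ Finset.range n, K * (∫ ω, R (k + 1) ω ∂P - ∫ ω, R k ω ∂P) :=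
          Finset.sum_le_sum fun k _ => h k
      _ = K * (∫ ω, R n ω ∂P - ∫ ω, R 0 ω ∂P) := by
          rw [← Finset.mul_sum, Finset.sum_range_sub fun k => ∫ ω, R k ω ∂P]
      _ ≤ K * ∫ ω, R n ω ∂P := by
          have : 0 ≤ ∫ ω, R 0 ω ∂P := integral_nonneg (hR.nonneg 0)
          exact mul_le_mul_of_nonneg_left (by linarith) hK
  have hV0 : 0 ≤ ∫ ω, R 0 ω ^ 2 ∂P := integral_nonneg fun ω => sq_nonneg _
  have hm : 0 ≤ p ^ 2 * v + q ^ 2 * (1 - v) := by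
    have : 0 ≤ v := hμ.integral_sq ▸ integral_nonneg fun s => sq_nonneg s
    have : 0 ≤ 1 - v := by linarith
    positivity
  refine ⟨K * (1 + (∫ ω, R 0 ω ^ 2 ∂P + (p ^ 2 * v + q ^ 2 * (1 - v)))), by positivity,
    fun k => (h1 _).trans ?_⟩
  rw [mul_assoc]
  refine mul_le_mul_of_nonneg_left ?_ hK
  have h2 := hR.integral_sq_le hμ hp hq (4 ^ k)
  have i2 := hR.integrable_comp hμ hp hq (G := fun x => x ^ 2) (by fun_prop) (4 ^ k)
  have i1 := hR.integrable_comp hμ hp hq (G := fun x => x) (by fun_prop) (4 ^ k)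
  have ht : (0 : ℝ) < 2 ^ k := by positivity
  have h4 : ((4 ^ k : ℕ) : ℝ) = 2 ^ k * 2 ^ k := by
    push_cast
    rw [← mul_pow]
    norm_num
  -- `R ≤ t + R² / t` with `t = 2^k`, the square root of the time, gives the diffusive bound on the
  -- first moment.
  have h3 : ∫ ω, R (4 ^ k) ω ∂P ≤ ∫ ω, (2 ^ k + R (4 ^ k) ω ^ 2 / 2 ^ k) ∂P := by
    refine integral_mono i1 ((integrable_const _).add (i2.div_const _)) fun ω => ?_
    simp only
    rw [← sub_le_iff_le_add', le_div_iff₀ ht]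
    nlinarith [sq_nonneg (R (4 ^ k) ω - 2 ^ k), hR.nonneg (4 ^ k) ω]
  rw [integral_add (integrable_const _) (i2.div_const _), integral_div] at h3
  simp only [integral_const, probReal_univ, one_smul] at h3
  refine h3.trans ?_
  rw [add_mul, one_mul, add_le_add_iff_left, div_le_iff₀ ht, mul_assoc, ← h4]
  refine h2.trans ?_
  have h5 : (1 : ℝ) ≤ ((4 ^ k : ℕ) : ℝ) := by exact_mod_cast Nat.one_le_pow _ _ (by norm_num)
  nlinarith

end IsRadialChain

/-- A monotone sequence is sublinear as soon as it is so along the powers of `4`. -/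
lemma tendsto_div_of_tendsto_four_pow {u : ℕ → ℝ} (hu : Monotone u) (h0 : ∀ n, 0 ≤ u n)
    (h : Tendsto (fun k : ℕ => u (4 ^ k) / 4 ^ k) atTop (𝓝 0)) :
    Tendsto (fun n : ℕ => u n / n) atTop (𝓝 0) := by
  have hlog : Tendsto (fun n => Nat.log 4 n + 1) atTop atTop := by
    refine tendsto_atTop.2 fun k => ?_
    filter_upwards [eventually_ge_atTop (4 ^ k)] with n hn
    exact (Nat.le_log_of_pow_le (by norm_num) hn).trans (Nat.le_succ _)
  -- Rounding `n` up to a power of `4` costs at most a factor `4`.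
  have h4 : Tendsto (fun n => 4 * (u (4 ^ (Nat.log 4 n + 1)) / 4 ^ (Nat.log 4 n + 1)))
      atTop (𝓝 0) := by
    simpa using (h.comp hlog).const_mul 4
  refine squeeze_zero' (Eventually.of_forall fun n => div_nonneg (h0 n) n.cast_nonneg) ?_ h4
  filter_upwards [eventually_ge_atTop 1] with n hn
  have hn0 : (0 : ℝ) < n := by exact_mod_cast hn
  have h1 : n < 4 ^ (Nat.log 4 n + 1) := Nat.lt_pow_succ_log_self (by norm_num) n
  have h2 : (4 : ℝ) ^ Nat.log 4 n ≤ n := by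
    exact_mod_cast Nat.pow_log_le_self 4 (by omega)
  rw [pow_succ (4 : ℝ), div_le_iff₀ hn0]
  have h3 := hu h1.le
  have h5 := h0 (4 ^ (Nat.log 4 n + 1))
  set w := u (4 ^ (Nat.log 4 n + 1))
  have h6 : (0 : ℝ) < 4 ^ Nat.log 4 n := by positivity
  calc u n ≤ w := h3
    _ = w / 4 ^ Nat.log 4 n * 4 ^ Nat.log 4 n := by field_simp
    _ ≤ w / 4 ^ Nat.log 4 n * n := by gcongr
    _ = _ := by field_simp

namespace IsRadialChain

variable {Ω : Type*} [mΩ : MeasurableSpace Ω] {P : Measure Ω} [IsProbabilityMeasure P]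
  {ℱ : Filtration ℕ mΩ} {p q v : ℝ} {μ : Measure ℝ} {R : ℕ → Ω → ℝ}

/-- The expected proportions at times `4^k` are at most `D / 2^k`. Their random sum thus has finite
mean and converges almost surely, so its terms tend to `0`. -/
lemma ae_tendsto_visits (hR : IsRadialChain P ℱ p q μ R) (hμ : IsNoise μ v) (hv : v < 1)
    (hp : 0 < p) (hq : 0 < q) {L : ℝ} (hL : 0 ≤ L) :
    ∀ᵐ ω ∂P, Tendsto (fun n => visits R L n ω / n) atTop (𝓝 0) := by
  obtain ⟨D, hD, h⟩ := hR.integral_visits_le hμ hv hp hq hL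
  have hint : ∀ n, Integrable (visits R L n) P := fun n =>
    Integrable.of_bound (hR.measurable_visits L n).aestronglyMeasurable n
      (Eventually.of_forall fun ω => by
        rw [Real.norm_eq_abs, abs_of_nonneg (visits_nonneg L n ω)]
        exact visits_le L n ω)
  have hm : ∀ k : ℕ, Measurable fun ω => ENNReal.ofReal (visits R L (4 ^ k) ω / 4 ^ k) := fun k =>
    ENNReal.measurable_ofReal.comp ((hR.measurable_visits L _).div_const _)
  have h1 : ∀ k : ℕ, ∫⁻ ω, ENNReal.ofReal (visits R L (4 ^ k) ω / 4 ^ k) ∂P ≤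
      ENNReal.ofReal (D * (1 / 2) ^ k) := by
    intro k
    rw [← ofReal_integral_eq_lintegral_ofReal ((hint _).div_const _)
      (Eventually.of_forall fun ω => div_nonneg (visits_nonneg L _ ω) (by positivity)),
      integral_div]
    refine ENNReal.ofReal_le_ofReal ?_
    rw [div_le_iff₀ (by positivity)]
    refine (h k).trans (le_of_eq ?_)
    rw [mul_assoc, ← mul_pow]
    norm_num
  have h2 : ∫⁻ ω, ∑' k : ℕ, ENNReal.ofReal (visits R L (4 ^ k) ω / 4 ^ k) ∂P ≠ ∞ := by
    rw [lintegral_tsum fun k => (hm k).aemeasurable]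
    refine ne_top_of_le_ne_top ?_ (ENNReal.tsum_le_tsum h1)
    rw [← ENNReal.ofReal_tsum_of_nonneg (fun k => by positivity)
      ((summable_geometric_of_lt_one (by norm_num) (by norm_num)).mul_left D)]
    exact ENNReal.ofReal_ne_top
  filter_upwards [ae_lt_top (Measurable.tsum hm) h2] with ω hω
  refine tendsto_div_of_tendsto_four_pow (visits_mono L ω) (fun n => visits_nonneg L n ω) ?_
  have h3 := (ENNReal.tendsto_toReal ENNReal.zero_ne_top).comp
    (ENNReal.tendsto_atTop_zero_of_tsum_ne_top hω.ne)
  refine h3.congr fun k => ?_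
  exact ENNReal.toReal_ofReal (div_nonneg (visits_nonneg L _ ω) (by positivity))

/-- A path that stays in `[0, M]` from time `N` on has at least `n - N` visits before time `n`,
contradicting nullity. No ellipticity or irreducibility argument is needed. -/
lemma ae_frequently_gt (hR : IsRadialChain P ℱ p q μ R) (hμ : IsNoise μ v) (hv : v < 1)
    (hp : 0 < p) (hq : 0 < q) : ∀ᵐ ω ∂P, ∀ L : ℝ, ∃ᶠ n in atTop, L < R n ω := by
  have h : ∀ᵐ ω ∂P, ∀ L : ℕ, Tendsto (fun n => visits R L n ω / n) atTop (𝓝 0) :=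
    ae_all_iff.2 fun L => hR.ae_tendsto_visits hμ hv hp hq L.cast_nonneg
  filter_upwards [h] with ω hω L
  obtain ⟨M, hM⟩ := exists_nat_ge L
  by_contra hf
  rw [not_frequently] at hf
  obtain ⟨N, hN⟩ := eventually_atTop.1 hf
  have hlow : ∀ n : ℕ, (n : ℝ) - N ≤ visits R M n ω := by
    intro n
    induction n with
    | zero => simp [visits]
    | succ n ih =>
      rcases lt_or_ge n N with hn | hn
      · have : ((n + 1 : ℕ) : ℝ) ≤ N := by exact_mod_cast hn
        linarith [visits_nonneg (R := R) M (n + 1) ω]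
      · have : ω ∈ {ω | R n ω ≤ M} := (not_lt.1 (hN n hn)).trans hM
        rw [visits, Finset.sum_range_succ, Set.indicator_of_mem this]
        rw [visits] at ih
        push_cast
        linarith
  obtain ⟨n, hn, hn2⟩ := (((hω M).eventually_lt_const (by norm_num : (0 : ℝ) < 1 / 2)).and
    (eventually_ge_atTop (2 * N + 1))).exists
  have hn0 : (0 : ℝ) < n := by exact_mod_cast (by omega : 0 < n)
  rw [div_lt_iff₀ hn0] at hn
  have : (2 * N + 1 : ℝ) ≤ n := by exact_mod_cast hn2
  linarith [hlow n]

end IsRadialChain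

/-! ### Transience and recurrence of the radial chain -/

variable {Ω : Type*} [mΩ : MeasurableSpace Ω] {P : Measure Ω} {ℱ : Filtration ℕ mΩ}

/-- The chain observed from time `k` on. -/
lemma IsRadialChain.shift {p q v : ℝ} {μ : Measure ℝ} {R : ℕ → Ω → ℝ}
    (hR : IsRadialChain P ℱ p q μ R) (hμ : IsNoise μ v) (hp : 0 < p) (hq : 0 < q)
    (k : ℕ) : IsRadialChain P
      (⟨fun n => ℱ (n + k), fun _ _ h => ℱ.mono (Nat.add_le_add_right h k), fun _ => ℱ.le _⟩ :
        Filtration ℕ mΩ) p q μ (fun n => R (n + k)) where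
  adapted n := hR.adapted _
  nonneg n := hR.nonneg _
  start := by simpa using hR.ae_le hμ hp hq k
  step n E hE g hg := by
    have := hR.step (n + k) E hE g hg
    rwa [show n + k + 1 = n + 1 + k by ring] at this

variable [IsProbabilityMeasure P]

/-- A non-negative supermartingale converges almost surely. -/
lemma exists_ae_tendsto_of_supermartingale {Y : ℕ → Ω → ℝ} (hY : Supermartingale Y ℱ P)
    (h0 : ∀ n ω, 0 ≤ Y n ω) : ∀ᵐ ω ∂P, ∃ c, Tendsto (fun n => Y n ω) atTop (𝓝 c) := by
  have hbdd : ∀ n, eLpNorm ((-Y) n) 1 P ≤ (∫ ω, Y 0 ω ∂P).toNNReal := by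
    intro n
    rw [Pi.neg_apply, eLpNorm_neg, eLpNorm_one_eq_lintegral_enorm]
    simp only [Real.enorm_of_nonneg (h0 n _)]
    rw [← ofReal_integral_eq_lintegral_ofReal (hY.integrable n) (Eventually.of_forall (h0 n))]
    refine ENNReal.ofReal_le_ofReal ?_
    have := hY.setIntegral_le (Nat.zero_le n) MeasurableSet.univ
    simpa using this
  filter_upwards [hY.neg.exists_ae_tendsto_of_bdd hbdd] with ω ⟨c, hc⟩
  exact ⟨-c, by simpa using hc.neg⟩

namespace IsRadialChain

variable {p q v : ℝ} {μ : Measure ℝ} {R : ℕ → Ω → ℝ}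

lemma ae_tendsto_atTop (hR : IsRadialChain P ℱ p q μ R) (hμ : IsNoise μ v) (hv : 0 < v)
    (hv1 : v < 1) (hp : 0 < p) (hq : 0 < q) (h : p ^ 2 * v < q ^ 2 * (1 - v)) :
    ∀ᵐ ω ∂P, Tendsto (fun n => R n ω) atTop atTop := by
  obtain ⟨κ, r₁, hκ, hr₁, hdrift⟩ := exists_integral_exp_le hμ hv hp hq h
  have hmax : ∀ x, 0 < max x r₁ ^ 2 := fun x => pow_pos (lt_max_of_lt_right (by linarith)) 2
  -- Freezing the negative power below `r₁` makes `F r₁` its maximum, so inside `[0, r₁]` the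
  -- supermartingale inequality is automatic; outside it is the drift estimate.
  set F : ℝ → ℝ := fun x => Real.exp (-(κ * Real.log (max x r₁ ^ 2))) with hF
  have hFc : Continuous F := Real.continuous_exp.comp ((continuous_const.mul
    (((continuous_id.max continuous_const).pow 2).log fun x => (hmax x).ne')).neg)
  have hF0 : ∀ x, 0 < F x := fun x => Real.exp_pos _
  have hFanti : Antitone F := fun x y hxy => by
    simp only [hF]
    have := hmax x
    gcongr
  have hsuper : Supermartingale (fun n ω => F (R n ω)) ℱ P := by
    refine supermartingale_of_setIntegral_succ_le
      (fun n => (hFc.measurable.comp (hR.adapted n)).stronglyMeasurable)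
      (fun n => hR.integrable_comp hμ hp hq hFc n) fun n E hE =>
      hR.setIntegral_succ_le hμ hp hq hFc (fun x => (hF0 x).le) hE fun ω _ => ?_
    have hi := integrable_radialStep (p := p) (q := q) hμ hp hq hFc (hR.nonneg n ω)
    have := hμ.prob
    rcases le_total r₁ (R n ω) with hr | hr
    · obtain ⟨h1, h2, h3⟩ := hdrift _ hr
      have e : F (R n ω) = Real.exp (-(κ * Real.log (R n ω ^ 2))) := by
        simp only [hF, max_eq_left hr]
      rw [e]
      refine (integral_mono_ae hi h2 ?_).trans h3
      filter_upwards [hμ.abs_le] with s hs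
      have := h1 s hs
      simp only [hF]
      gcongr
      exact le_max_left _ _
    · have e : F (R n ω) = F r₁ := by simp only [hF, max_eq_right hr, max_self]
      rw [e]
      have : ∫ s, F (radialStep p q (R n ω) s) ∂μ ≤ ∫ _, F r₁ ∂μ := by
        refine integral_mono hi (integrable_const _) fun s => ?_
        simp only [hF, max_self]
        gcongr
        exact le_max_right _ _
      simpa using this
  have hFlim : Tendsto F atTop (𝓝 0) := by
    refine Real.tendsto_exp_atBot.comp (tendsto_neg_atTop_atBot.comp
      (Tendsto.const_mul_atTop hκ (Real.tendsto_log_atTop.comp ?_)))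
    exact (tendsto_pow_atTop two_ne_zero).comp
      (tendsto_atTop_mono (fun x => le_max_left x r₁) tendsto_id)
  filter_upwards [exists_ae_tendsto_of_supermartingale hsuper fun n ω => (hF0 _).le,
    hR.ae_frequently_gt hμ hv1 hp hq] with ω ⟨l, hl⟩ hfreq
  -- `R` exceeds every level infinitely often, and there `F` is arbitrarily small. Since `F` is
  -- positive and antitone, a limit `0` then forces `R → ∞`.
  have hl0 : l ≤ 0 := by
    by_contra! hpos
    obtain ⟨L, hL⟩ := eventually_atTop.1 (hFlim.eventually_lt_const (half_pos hpos))
    have h2 : ∀ᶠ n in atTop, l / 2 < F (R n ω) := hl.eventually_const_lt (half_lt_self hpos)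
    obtain ⟨n, h3, h4⟩ := ((hfreq L).and_eventually h2).exists
    exact lt_asymm h4 (hL _ h3.le)
  refine tendsto_atTop.2 fun L => ?_
  have h2 : ∀ᶠ n in atTop, F (R n ω) < F L := hl.eventually_lt_const (hl0.trans_lt (hF0 L))
  filter_upwards [h2] with n hn
  by_contra! hlt
  exact absurd hn (not_lt.2 (hFanti hlt.le))

/-- The process `G (R n)`, set to `0` once the chain has entered `[0, r₁]`, is a non-negative
supermartingale; the killing only lowers it since `G ≥ 0`. On a path that never enters, convergence
would keep `G (R n)` bounded, while `R` is unbounded and `G → ∞`. -/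
lemma exists_ae_hit (hR : IsRadialChain P ℱ p q μ R) (hμ : IsNoise μ v) (hv1 : v < 1)
    (hp : 0 < p) (hq : 0 < q) {C r₁ : ℝ}
    (hdrift : ∀ r, r₁ ≤ r → 1 ≤ r ^ 2 - C ∧
      ∫ s, Real.log (max (radialStep p q r s ^ 2 - C) 1) ∂μ ≤ Real.log (r ^ 2 - C)) :
    ∀ᵐ ω ∂P, ∃ n, R n ω ≤ r₁ := by
  set G : ℝ → ℝ := fun x => Real.log (max (x ^ 2 - C) 1) with hG
  have hGc : Continuous G :=
    ((((continuous_id.pow 2).sub continuous_const).max continuous_const).log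
      fun x => (lt_max_of_lt_right one_pos).ne')
  have hG0 : ∀ x, 0 ≤ G x := fun x => Real.log_nonneg (le_max_right _ _)
  set A : ℕ → Set Ω := fun n => {ω | ∀ j ≤ n, r₁ < R j ω} with hA
  have hAm : ∀ n, MeasurableSet[ℱ n] (A n) := by
    intro n
    have : A n = ⋂ j, ⋂ (_ : j ≤ n), {ω | r₁ < R j ω} := by
      ext ω
      simp [hA]
    rw [this]
    refine MeasurableSet.iInter fun j => MeasurableSet.iInter fun hj => ?_
    exact ℱ.mono hj _ (measurableSet_lt measurable_const (hR.adapted j))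
  have hint := hR.integrable_comp hμ hp hq hGc
  have hsuper : Supermartingale (fun n => (A n).indicator fun ω => G (R n ω)) ℱ P := by
    refine supermartingale_of_setIntegral_succ_le
      (fun n => ((hGc.measurable.comp (hR.adapted n)).indicator (hAm n)).stronglyMeasurable)
      (fun n => (hint n).indicator (ℱ.le n _ (hAm n))) fun n E hE => ?_
    have hEm := ℱ.le n _ hE
    have hAm' := ℱ.le n _ (hAm n)
    have hA1 := ℱ.le (n + 1) _ (hAm (n + 1))
    have hsub : A (n + 1) ⊆ A n := fun ω hω j hj => hω j (hj.trans n.le_succ)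
    calc ∫ ω in E, (A (n + 1)).indicator (fun ω => G (R (n + 1) ω)) ω ∂P
        ≤ ∫ ω in E, (A n).indicator (fun ω => G (R (n + 1) ω)) ω ∂P :=
          integral_mono ((hint _).indicator hA1).integrableOn
            ((hint _).indicator hAm').integrableOn
            fun ω => Set.indicator_le_indicator_of_subset hsub (fun ω => hG0 _) ω
      _ = ∫ ω in E ∩ A n, G (R (n + 1) ω) ∂P := setIntegral_indicator hAm'
      _ ≤ ∫ ω in E ∩ A n, G (R n ω) ∂P := by
          refine hR.setIntegral_succ_le hμ hp hq hGc hG0 (hE.inter (hAm n)) fun ω hω => ?_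
          obtain ⟨h1, h2⟩ := hdrift _ (hω.2 n le_rfl).le
          simpa only [hG, max_eq_left h1] using h2
      _ = ∫ ω in E, (A n).indicator (fun ω => G (R n ω)) ω ∂P := (setIntegral_indicator hAm').symm
  have hGlim : Tendsto G atTop atTop := by
    refine Real.tendsto_log_atTop.comp (tendsto_atTop_mono (fun x => le_max_left _ _) ?_)
    exact tendsto_atTop_add_const_right _ (-C) (tendsto_pow_atTop two_ne_zero)
  filter_upwards [exists_ae_tendsto_of_supermartingale hsuper
    fun n ω => Set.indicator_nonneg (fun ω _ => hG0 _) ω,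
    hR.ae_frequently_gt hμ hv1 hp hq] with ω ⟨l, hl⟩ hfreq
  by_contra! hno
  have hmem : ∀ n, ω ∈ A n := fun n j _ => hno j
  have h1 : ∀ᶠ n in atTop, G (R n ω) < l + 1 := by
    filter_upwards [hl.eventually_lt_const (lt_add_one l)] with n hn
    rwa [Set.indicator_of_mem (hmem n)] at hn
  obtain ⟨L, hL⟩ := eventually_atTop.1 (hGlim.eventually_ge_atTop (l + 1))
  obtain ⟨n, h3, h4⟩ := ((hfreq L).and_eventually h1).exists
  exact absurd h4 (not_lt.2 (hL _ h3.le))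

lemma exists_ae_frequently_le (hR : IsRadialChain P ℱ p q μ R) (hμ : IsNoise μ v) (hv : 0 < v)
    (hv1 : v < 1) (hp : 0 < p) (hq : 0 < q) (h : q ^ 2 * (1 - v) ≤ p ^ 2 * v) :
    ∃ r₁ : ℝ, 0 < r₁ ∧ ∀ᵐ ω ∂P, ∃ᶠ n in atTop, R n ω ≤ r₁ := by
  obtain ⟨C, r₁, hr₁, hdrift⟩ := exists_integral_log_le hμ hv hp hq h
  refine ⟨r₁, hr₁, ?_⟩
  -- The hitting statement, applied to the chain restarted at each time `k`, yields a visit after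
  -- every time.
  have hk := ae_all_iff.2 fun k => (hR.shift hμ hp hq k).exists_ae_hit hμ hv1 hp hq hdrift
  filter_upwards [hk] with ω hω
  refine frequently_atTop.2 fun k => ?_
  obtain ⟨n, hn⟩ := hω k
  exact ⟨n + k, Nat.le_add_left _ _, hn⟩

end IsRadialChain

/-! ### The elliptic random walk -/

lemma occupation_nonneg {α : Type*} {d : ℕ} (X : ℕ → α → Vec d) (A : Set (Vec d)) (n : ℕ) (ω : α) :
    0 ≤ occupation X A n ω :=
  mul_nonneg (by positivity)
    (Finset.sum_nonneg fun _ _ => Set.indicator_nonneg (fun _ _ => zero_le_one) _)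

lemma occupation_le_visits {α : Type*} {d : ℕ} (X : ℕ → α → Vec d) {A : Set (Vec d)} {L : ℝ}
    (hA : A ⊆ Metric.closedBall 0 L) (n : ℕ) (ω : α) :
    occupation X A n ω ≤ IsRadialChain.visits (fun n ω => ‖X n ω‖) L n ω / n := by
  rw [occupation, one_div, div_eq_inv_mul]
  refine mul_le_mul_of_nonneg_left (Finset.sum_le_sum fun k _ => ?_) (by positivity)
  refine Set.indicator_apply_le' (fun h => ?_)
    fun _ => Set.indicator_nonneg (fun _ _ => zero_le_one) _
  have : ω ∈ {ω | ‖X k ω‖ ≤ L} := by simpa using hA h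
  rw [Set.indicator_of_mem this]

/-- Bounded convergence in `L^q`. -/
lemma tendsto_eLpNorm_zero_of_ae {f : ℕ → Ω → ℝ} (hm : ∀ n, Measurable (f n))
    (h0 : ∀ n ω, 0 ≤ f n ω) (h1 : ∀ n ω, f n ω ≤ 1)
    (h : ∀ᵐ ω ∂P, Tendsto (fun n => f n ω) atTop (𝓝 0)) {q : ℝ} (hq : 1 ≤ q) :
    Tendsto (fun n => eLpNorm (f n) (ENNReal.ofReal q) P) atTop (𝓝 0) := by
  have hq0 : 0 < q := by linarith
  have hlim : Tendsto (fun n => ∫⁻ ω, ‖f n ω‖ₑ ^ q ∂P) atTop (𝓝 (∫⁻ _, 0 ∂P)) := by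
    refine tendsto_lintegral_of_dominated_convergence (fun _ => 1)
      (fun n => (hm n).enorm.pow_const q) (fun n => Eventually.of_forall fun ω => ?_) (by simp) ?_
    · refine ENNReal.rpow_le_one ?_ hq0.le
      rw [Real.enorm_of_nonneg (h0 n ω)]
      exact ENNReal.ofReal_le_one.2 (h1 n ω)
    · filter_upwards [h] with ω hω
      have h2 := (ENNReal.continuous_rpow_const (y := q)).tendsto 0 |>.comp
        ((continuous_enorm.tendsto (0 : ℝ)).comp hω |>.trans (by simp))
      simpa [ENNReal.zero_rpow_of_pos hq0, Function.comp_def] using h2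
  have h3 := (ENNReal.continuous_rpow_const (y := 1 / q)).tendsto 0 |>.comp
    (by simpa using hlim : Tendsto (fun n => ∫⁻ ω, ‖f n ω‖ₑ ^ q ∂P) atTop (𝓝 0))
  rw [ENNReal.zero_rpow_of_pos (by positivity)] at h3
  refine h3.congr fun n => ?_
  rw [eLpNorm_eq_lintegral_rpow_enorm_toReal (by simpa using hq0) ENNReal.ofReal_ne_top,
    ENNReal.toReal_ofReal hq0.le]
  rfl

end EllipticWalk

theorem mainTheorem3 {Ω : Type*} [MeasurableSpace Ω] (P : Measure Ω) [IsProbabilityMeasure P]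
    (d : ℕ) (hd : 2 ≤ d) (a b : ℝ) (ha : 0 < a) (hb : 0 < b)
    (Q : EllipticWalk.Vec d → Matrix (Fin d) (Fin d) ℝ) (hQ : EllipticWalk.IsFrame Q)
    (x₀ : EllipticWalk.Vec d) (X : ℕ → Ω → EllipticWalk.Vec d)
    (hX : EllipticWalk.IsEllipticWalk P a b Q x₀ X) :
    (a ^ 2 < ((d : ℝ) - 1) * b ^ 2 → EllipticWalk.IsTransient P X) ∧
    (((d : ℝ) - 1) * b ^ 2 ≤ a ^ 2 → EllipticWalk.IsNullRecurrent P X) := by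
  have hd2 : (2 : ℝ) ≤ d := by exact_mod_cast hd
  have hd0 : (0 : ℝ) < d := by linarith
  have hp : 0 < √(d : ℝ) * a := by positivity
  have hq : 0 < √(d : ℝ) * b := by positivity
  have hv0 : (0 : ℝ) < 1 / d := by positivity
  have hv1 : (1 : ℝ) / d < 1 := by
    rw [div_lt_one hd0]
    linarith
  have hμ := EllipticWalk.isNoise_coordLaw hd
  have hR := hX.isRadialChain hd hQ
  -- With `v = 1 / d`, the two sides of the radial criterion become `a²` and `(d - 1) b²`.
  have ea : (√(d : ℝ) * a) ^ 2 * (1 / d) = a ^ 2 := by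
    rw [mul_pow, Real.sq_sqrt hd0.le]
    field_simp
  have eb : (√(d : ℝ) * b) ^ 2 * (1 - 1 / d) = ((d : ℝ) - 1) * b ^ 2 := by
    rw [mul_pow, Real.sq_sqrt hd0.le]
    field_simp
  refine ⟨fun h => hR.ae_tendsto_atTop hμ hv0 hv1 hp hq (by rwa [ea, eb]), fun h => ⟨?_, ?_⟩⟩
  · obtain ⟨r₁, hr₁, hfreq⟩ := hR.exists_ae_frequently_le hμ hv0 hv1 hp hq (by rwa [ea, eb])
    refine ⟨r₁.toNNReal, ?_⟩
    filter_upwards [hfreq] with ω hω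
    refine liminf_le_of_frequently_le' (hω.mono fun n hn => ?_)
    rw [← ofReal_norm]
    exact ENNReal.ofReal_le_ofReal hn
  · intro A hA
    obtain ⟨L, hL, hAL⟩ := hA.subset_closedBall_lt 0 0
    have hvis := hR.ae_tendsto_visits hμ hv1 hp hq hL.le
    refine ⟨?_, fun s hs => ?_⟩
    · filter_upwards [hvis] with ω hω
      exact squeeze_zero (fun n => EllipticWalk.occupation_nonneg X A n ω)
        (fun n => EllipticWalk.occupation_le_visits X hAL n ω) hω
    -- `A` need not be measurable, so dominated convergence is applied to the proportion of visits
    -- to a ball containing `A`, and the seminorms are compared.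
    · refine tendsto_of_tendsto_of_tendsto_of_le_of_le tendsto_const_nhds
        (EllipticWalk.tendsto_eLpNorm_zero_of_ae
          (fun n => (hR.measurable_visits L n).div_const _)
          (fun n ω => div_nonneg (EllipticWalk.IsRadialChain.visits_nonneg L n ω) n.cast_nonneg)
          (fun n ω => div_le_one_of_le₀ (EllipticWalk.IsRadialChain.visits_le L n ω) n.cast_nonneg)
          hvis hs) (fun n => zero_le) fun n => ?_
      refine eLpNorm_mono_real fun ω => ?_
      rw [Real.norm_eq_abs, abs_of_nonneg (EllipticWalk.occupation_nonneg X A n ω)]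
      exact EllipticWalk.occupation_le_visits X hAL n ω
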